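/- Let $n\ge 0$, $S^1=\mathbb R/2\pi\mathbb Z$, let $J$ be multiplication by $i$ on $\mathbb C^n$, and let $H:\mathbb C^n\times S^1\to\mathbb R$ be differentiable in the first variable, with Hamiltonian vector field $X_H=J\nabla H$ (gradient in the $\mathbb C^n$-variable) of the form $$X_H(x,\theta)=c\,x+X_{c}(x,\theta),$$ where $c\in i\mathbb R$ is constant and $X_{c}:\mathbb C^n\times S^1\to\mathbb C^n$ is $C^1$ with compact support. (For instance, $H$ may be smooth and independent of $\theta$, zero near $0$, and equal to $(1+\delta)|x|^2$ for $|x|$ large.) Let $\mathcal B=L^2_{1/2}(S^1,\mathbb C^n)$ be the space of $L^2$ loops $b=\sum_k c_ke^{ik\theta}$ with $|c_0|^2+\sum_k|k||c_k|^2<\infty$. Let $L=J\partial_\theta$, and let $\Pi^+$ and $\Pi^-$ be the spectral projections to its nonnegative and negative spectrum. For $u\in L^2_1([0,\epsilon]\times S^1,\mathbb C^n)$ with traces $r_0u$, $r_\epsilon u$ at $t=0$ and $t=\epsilon$, the mixed boundary value of $u$ is $$b=b^+_0+b^-_\epsilon,\qquad b^+_0=-\Pi^+r_0u,\quad b^-_\epsilon=\Pi^-r_\epsilon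 u .$$ The perturbed holomorphic curve equation is $$\partial_tu+J\bigl(\partial_\theta u-X_H(u,\theta)\bigr)=0\quad\text{a.e. on }[0,\epsilon]\times S^1,$$ and the energy is $E(u)=\frac12\int_0^\epsilon\int_0^{2\pi}|\partial_tu|^2+|\partial_\theta u-X_H(u,\theta)|^2\,d\theta\,dt$. Then: 1. There is $\epsilon_0>0$, depending only on $H$, such that for all $0<\epsilon\le\epsilon_0$ and all $b\in\mathcal B$ there is a unique $u\in L^2_1([0,\epsilon]\times S^1,\mathbb C^n)$ which solves the perturbed holomorphic curve equation and has mixed boundary value $b$. 2. For every $b\in\mathcal B$ and every $\eta>0$ there is $\epsilon_0>0$ such that for all $0<\epsilon\le\epsilon_0$ there is a unique $u\in L^2_1([0,\epsilon]\times S^1,\mathbb C^n)$ which solves the perturbed holomorphic curve equation, has mixed boundary value $b$, and satisfies $E(u)<\eta$. -/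

import Mathlib

open MeasureTheory Filter Topology

noncomputable section

/-- The target space `ℂⁿ` with its Euclidean norm; the complex structure `J` is
multiplication by `Complex.I`. -/
abbrev Cn (n : ℕ) : Type := EuclideanSpace ℂ (Fin n)

/-- The Hamiltonian vector field `X_H = J ∘ ∇H` of `H : ℂⁿ × S¹ → ℝ`. The gradient is taken in the
`ℂⁿ` variable, for the real Euclidean structure of `ℂⁿ`; functions on the circle `S¹ = ℝ / 2πℤ` are
functions of an angle `θ : ℝ`. -/
def hamVF {n : ℕ} (H : Cn n → ℝ → ℝ) (x : Cn n) (θ : ℝ) : Cn n :=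
  Complex.I • gradient (fun y => H y θ) x

/-- Hamiltonians `H : ℂⁿ × S¹ → ℝ` with `X_H(x, θ) = c • x + X_c(x, θ)`, where `c` is an imaginary
constant and `X_c : ℂⁿ × S¹ → ℂⁿ` is `C¹` with compact support. -/
structure AdmissibleHamiltonian {n : ℕ} (H : Cn n → ℝ → ℝ) : Prop where
  periodic : ∀ x θ, H x (θ + 2 * Real.pi) = H x θ
  differentiable : ∀ θ, Differentiable ℝ (fun x => H x θ)
  decomposition : ∃ (a R : ℝ) (Xc : Cn n → ℝ → Cn n),
    ContDiff ℝ 1 (fun p : Cn n × ℝ => Xc p.1 p.2) ∧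
    (∀ x θ, R ≤ ‖x‖ → Xc x θ = 0) ∧
    ∀ x θ, hamVF H x θ = ((a : ℂ) * Complex.I) • x + Xc x θ

/-! ### Loops -/

/-- The measure `dθ` on the circle of length `2π`, on a fundamental domain. -/
def circleMeasure : Measure ℝ := volume.restrict (Set.Ioo 0 (2 * Real.pi))

/-- The Fourier coefficient `c_k` of a loop `f(θ) = ∑ c_k e^{ikθ}`. -/
def loopCoeff {n : ℕ} (f : ℝ → Cn n) (k : ℤ) : Cn n :=
  fourierCoeffOn Real.two_pi_pos f k

/-- The loop `b` lies in `L²_{1/2}(S¹, ℂⁿ)`: `∑ |k| |c_k|² + |c_0|² < ∞`. -/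
def MemLHalf {n : ℕ} (b : ℝ → Cn n) : Prop :=
  MemLp b 2 circleMeasure ∧ Summable fun k : ℤ => |(k : ℝ)| * ‖loopCoeff b k‖ ^ 2

/-- The eigenvalue of `L = J ∂_θ` on the loops `θ ↦ e^{ikθ} v`, `v ∈ ℂⁿ`. -/
def eigL (k : ℤ) : ℝ := -(k : ℝ)

/-- Fourier coefficients of `Π⁺ f`, the projection of `f` to the nonnegative spectrum of `L`. -/
def specPlus {n : ℕ} (f : ℝ → Cn n) (k : ℤ) : Cn n :=
  open Classical in if 0 ≤ eigL k then loopCoeff f k else 0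

/-- Fourier coefficients of `Π⁻ f`, the projection of `f` to the negative spectrum of `L`. -/
def specMinus {n : ℕ} (f : ℝ → Cn n) (k : ℤ) : Cn n :=
  open Classical in if eigL k < 0 then loopCoeff f k else 0

/-! ### Maps on the cylinder -/

/-- The measure `dt dθ` on the cylinder `[0, ε] × S¹`, on a fundamental domain. -/
def cylMeasure (ε : ℝ) : Measure (ℝ × ℝ) :=
  volume.restrict (Set.Ioo 0 ε ×ˢ Set.Ioo 0 (2 * Real.pi))

/-- Smooth real functions on `ℝ × S¹`. -/
structure IsSmoothOnCyl (φ : ℝ × ℝ → ℝ) : Prop where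
  smooth : ContDiff ℝ ((⊤ : ℕ∞) : WithTop ℕ∞) φ
  periodic : ∀ t θ, φ (t, θ + 2 * Real.pi) = φ (t, θ)

/-- `w` is the weak derivative of `u` in the direction `e` on the cylinder `(0, ε) × S¹`. The test
functions are compactly supported in `(0, ε) × S¹`; there is no condition in the `θ` direction
beyond periodicity. -/
def IsWeakDeriv {n : ℕ} (ε : ℝ) (e : ℝ × ℝ) (u w : ℝ × ℝ → Cn n) : Prop :=
  ∀ φ : ℝ × ℝ → ℝ, IsSmoothOnCyl φ →
    (∃ δ > 0, ∀ t θ, t ≤ δ ∨ ε - δ ≤ t → φ (t, θ) = 0) →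
    ∫ p, (fderiv ℝ φ p e) • u p ∂(cylMeasure ε) = -∫ p, φ p • w p ∂(cylMeasure ε)

/-- The Sobolev space `L²_1([0, ε] × S¹, ℂⁿ)`: square-integrable maps `u` with square-integrable
weak derivatives `u_t` and `u_θ` (which are determined by `u`). -/
structure LOne (n : ℕ) (ε : ℝ) where
  u : Lp (Cn n) 2 (cylMeasure ε)
  ut : Lp (Cn n) 2 (cylMeasure ε)
  uθ : Lp (Cn n) 2 (cylMeasure ε)
  weak_t : IsWeakDeriv ε (1, 0) u ut
  weak_θ : IsWeakDeriv ε (0, 1) u uθ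

/-- `f₀` and `f₁` are the restrictions (traces) of `γ` to `{0} × S¹` and `{ε} × S¹`, characterised
by Green's formula against all smooth functions on the closed cylinder. -/
structure LOne.HasTraces {n : ℕ} {ε : ℝ} (γ : LOne n ε) (f₀ f₁ : ℝ → Cn n) : Prop where
  memLp_zero : MemLp f₀ 2 circleMeasure
  memLp_one : MemLp f₁ 2 circleMeasure
  green : ∀ φ : ℝ × ℝ → ℝ, IsSmoothOnCyl φ →
    ∫ p, ((fderiv ℝ φ p (1, 0)) • γ.u p + φ p • γ.ut p) ∂(cylMeasure ε) =
      ∫ θ, (φ (ε, θ) • f₁ θ - φ (0, θ) • f₀ θ) ∂circleMeasure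

/-- The mixed (APS) boundary value of `γ` is `b`: `Π⁻ (γ|_{t = ε}) - Π⁺ (γ|_{t = 0}) = b`. -/
def LOne.HasMixedBoundaryValue {n : ℕ} {ε : ℝ} (γ : LOne n ε) (b : ℝ → Cn n) : Prop :=
  ∃ f₀ f₁ : ℝ → Cn n, γ.HasTraces f₀ f₁ ∧
    ∀ k : ℤ, specMinus f₁ k - specPlus f₀ k = loopCoeff b k

/-- The perturbed holomorphic curve equation `∂_t u + J (∂_θ u - X_H(u)) = 0`. -/
def LOne.IsPerturbedHolomorphic {n : ℕ} {ε : ℝ} (γ : LOne n ε) (H : Cn n → ℝ → ℝ) : Prop :=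
  ∀ᵐ p ∂(cylMeasure ε), γ.ut p + Complex.I • (γ.uθ p - hamVF H (γ.u p) p.2) = 0

/-- The energy `½ ∫ |u_t|² + |u_θ - X_H(u)|²`. -/
def LOne.energy {n : ℕ} {ε : ℝ} (γ : LOne n ε) (H : Cn n → ℝ → ℝ) : ℝ :=
  (1 / 2) * ∫ p, (‖γ.ut p‖ ^ 2 + ‖γ.uθ p - hamVF H (γ.u p) p.2‖ ^ 2) ∂(cylMeasure ε)

end

noncomputable section

variable {n : ℕ} {ε : ℝ}

/-! ### The exponential basis of the circle -/

/-! In Fourier modes $u=\sum_k u_k(t)e^{ik\theta}$ the linear equation $\partial_tu+J\partial_\theta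
u=F$ becomes $u_k'=ku_k+F_k$. The mixed boundary value prescribes $u_k$ at $t=0$ for $k\le 0$ and at
$t=\epsilon$ for $k>0$, which is the end from which the homogeneous solution does not grow. The
solution operator of each mode is therefore dominated by the kernel $e^{-|k||t-s|}$, whose mass on
$(0,\epsilon)$ is at most $\min(\epsilon,2/|k|)$. With the Schur test this gives
`exists_linear_solution`: the $L^2$ norm of $u$ gains a factor $\epsilon$ over $F$, and the norm of
$\partial_\theta u$ is bounded by $F$ and a weighted sum of the boundary data. Linear uniqueness
(`LOne.eq_zero_of_linear`) turns the first bound into an estimate for differences of arbitrary weak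
solutions.

The nonlinearity $u\mapsto JX_H(u,\theta)$ is of order zero and globally Lipschitz on $L^2$, with a
constant $K$ depending only on $H$: $X_H$ is linear plus a $C^1$ field of compact support
(`AdmissibleHamiltonian.exists_lipschitzField`). For $\epsilon K\le 1/4$ the map that solves the
linear equation with right-hand side $JX_H(u,\theta)$ and boundary data $b$ is a contraction of
$L^2$. Its fixed point is the solution, and the threshold does not depend on $b$.

On solutions the energy equals $\|\partial_tu\|^2$. It is bounded by $O(\epsilon)$, with a constant
depending on $b$, plus a multiple of $\sum_k\min(k^2\epsilon,2|k|)|y_k|^2$, where $y_k$ are the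
normalised boundary coefficients. Since $b\in L^2_{1/2}$, dominated convergence sends this sum to
$0$ (`tendsto_tsum_modeWeight`), but not uniformly in $b$. Hence the solution of the first assertion
has small energy on short cylinders, and uniqueness in the second assertion is inherited from the
first. -/

instance isFiniteMeasure_circleMeasure : IsFiniteMeasure circleMeasure := by
  unfold circleMeasure; infer_instance

/-- The measure `dt` on `(0, ε)`. -/
def timeMeasure (ε : ℝ) : Measure ℝ := volume.restrict (Set.Ioo 0 ε)

instance isFiniteMeasure_timeMeasure (ε : ℝ) : IsFiniteMeasure (timeMeasure ε) := by
  unfold timeMeasure; infer_instance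

theorem cylMeasure_eq_prod (ε : ℝ) :
    cylMeasure ε = (timeMeasure ε).prod circleMeasure := by
  unfold cylMeasure timeMeasure circleMeasure
  rw [Measure.prod_restrict]; rfl

instance isFiniteMeasure_cylMeasure (ε : ℝ) : IsFiniteMeasure (cylMeasure ε) := by
  rw [cylMeasure_eq_prod]; infer_instance

theorem integral_circleMeasure {E : Type*} [NormedAddCommGroup E] [NormedSpace ℝ E] (f : ℝ → E) :
    ∫ θ, f θ ∂circleMeasure = ∫ θ in (0 : ℝ)..2 * Real.pi, f θ := by
  rw [intervalIntegral.integral_of_le Real.two_pi_pos.le, integral_Ioc_eq_integral_Ioo]; rfl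

theorem integral_timeMeasure {E : Type*} [NormedAddCommGroup E] [NormedSpace ℝ E] {ε : ℝ}
    (hε : 0 ≤ ε) (f : ℝ → E) :
    ∫ t, f t ∂(timeMeasure ε) = ∫ t in (0 : ℝ)..ε, f t := by
  rw [intervalIntegral.integral_of_le hε, integral_Ioc_eq_integral_Ioo]; rfl

/-- The orthonormal basis `(2π)^{-1/2} e^{ikθ}` of `L²(S¹)`. -/
def circleExp (k : ℤ) (θ : ℝ) : ℂ :=
  ((Real.sqrt (2 * Real.pi))⁻¹ : ℝ) * Complex.exp (k * Complex.I * θ)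

theorem contDiff_circleExp (k : ℤ) : ContDiff ℝ ((⊤ : ℕ∞) : WithTop ℕ∞) (circleExp k) := by
  unfold circleExp
  exact contDiff_const.mul ((contDiff_const.mul Complex.ofRealCLM.contDiff).cexp)

theorem continuous_circleExp (k : ℤ) : Continuous (circleExp k) := (contDiff_circleExp k).continuous

theorem hasDerivAt_circleExp (k : ℤ) (θ : ℝ) :
    HasDerivAt (circleExp k) (k * Complex.I * circleExp k θ) θ := by
  have h : HasDerivAt (fun θ : ℝ => (k * Complex.I * θ : ℂ)) (k * Complex.I) θ := by
    simpa using (Complex.ofRealCLM.hasDerivAt (x := θ)).const_mul (k * Complex.I : ℂ)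
  have := (h.cexp).const_mul (((Real.sqrt (2 * Real.pi))⁻¹ : ℝ) : ℂ)
  convert! this using 1
  unfold circleExp; ring

theorem norm_circleExp (k : ℤ) (θ : ℝ) : ‖circleExp k θ‖ = (Real.sqrt (2 * Real.pi))⁻¹ := by
  have : (k * Complex.I * θ : ℂ) = ((k * θ : ℝ) : ℂ) * Complex.I := by push_cast; ring
  rw [circleExp, norm_mul, this, Complex.norm_exp_ofReal_mul_I, mul_one, Complex.norm_real,
    Real.norm_of_nonneg (by positivity)]

theorem circleExp_add_two_pi (k : ℤ) (θ : ℝ) :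
    circleExp k (θ + 2 * Real.pi) = circleExp k θ := by
  unfold circleExp
  congr 1
  rw [Complex.exp_eq_exp_iff_exists_int]
  exact ⟨k, by push_cast; ring⟩

theorem conj_circleExp (k : ℤ) (θ : ℝ) :
    (starRingEnd ℂ) (circleExp k θ) = circleExp (-k) θ := by
  unfold circleExp
  rw [map_mul, Complex.conj_ofReal, ← Complex.exp_conj]
  congr 2
  simp

theorem integral_circleExp_mul (j k : ℤ) :
    ∫ θ, circleExp (-j) θ * circleExp k θ ∂circleMeasure = if j = k then 1 else 0 := by
  have h1 : ∀ θ, circleExp (-j) θ * circleExp k θ =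
      ((2 * Real.pi)⁻¹ : ℝ) * Complex.exp (((k - j : ℤ) * Complex.I) * θ) := by
    intro θ
    unfold circleExp
    have : ((2 * Real.pi)⁻¹ : ℝ) = (Real.sqrt (2 * Real.pi))⁻¹ * (Real.sqrt (2 * Real.pi))⁻¹ := by
      rw [← mul_inv, Real.mul_self_sqrt Real.two_pi_pos.le]
    rw [this, Complex.ofReal_mul, mul_mul_mul_comm, ← Complex.exp_add]
    congr 2
    push_cast; ring
  simp_rw [h1]
  rw [integral_circleMeasure, intervalIntegral.integral_const_mul]
  split_ifs with h
  · subst h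
    simp
    field_simp
  · have hne : ((k - j : ℤ) * Complex.I : ℂ) ≠ 0 := by
      refine mul_ne_zero ?_ Complex.I_ne_zero
      exact_mod_cast sub_ne_zero.2 (Ne.symm h)
    rw [integral_exp_mul_complex hne]
    have : Complex.exp ((k - j : ℤ) * Complex.I * ((2 * Real.pi : ℝ) : ℂ)) = 1 := by
      rw [Complex.exp_eq_one_iff]
      exact ⟨k - j, by push_cast; ring⟩
    rw [this]; simp

/-- Passes between the orthonormal normalisation used for the analysis and the coefficients $c_k$ of
the statement; the factor $\sqrt{2\pi}$ reappears in `LOne.modeBoundary`. -/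
theorem integral_circleExp_smul {n : ℕ} (f : ℝ → Cn n) (k : ℤ) :
    ∫ θ, circleExp (-k) θ • f θ ∂circleMeasure = Real.sqrt (2 * Real.pi) • loopCoeff f k := by
  rw [loopCoeff, fourierCoeffOn_eq_integral, integral_circleMeasure, smul_smul,
    ← intervalIntegral.integral_smul]
  refine intervalIntegral.integral_congr fun θ _ => ?_
  simp only [circleExp, fourier_coe_apply, sub_zero]
  rw [← Complex.coe_smul (Real.sqrt _ * _), smul_smul]
  congr 2
  · congr 1
    have h := Real.mul_self_sqrt Real.two_pi_pos.le
    have : 0 < √(2 * Real.pi) := by positivity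
    field_simp
    rw [sq, h]
  · congr 1
    have : (Real.pi : ℂ) ≠ 0 := by exact_mod_cast Real.pi_ne_zero
    push_cast
    field_simp

theorem integrable_circleExp_smul {n : ℕ} {f : ℝ → Cn n} (hf : Integrable f circleMeasure) (k : ℤ) :
    Integrable (fun θ => circleExp k θ • f θ) circleMeasure :=
  hf.bdd_smul _ (continuous_circleExp k).aestronglyMeasurable
    (Eventually.of_forall fun θ => (norm_circleExp k θ).le)

/-- Completeness of the exponentials: Parseval's identity for each of the $n$ scalar coordinates. -/
theorem ae_eq_zero_of_circleExp {n : ℕ} {f : ℝ → Cn n} (hf : MemLp f 2 circleMeasure)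
    (h : ∀ k, ∫ θ, circleExp (-k) θ • f θ ∂circleMeasure = 0) : f =ᵐ[circleMeasure] 0 := by
  have key : ∀ j : Fin n, ∀ᵐ θ ∂circleMeasure, f θ j = 0 := by
    intro j
    have hfj : MemLp (fun θ => f θ j) 2 circleMeasure :=
      (EuclideanSpace.proj (𝕜 := ℂ) j).comp_memLp' hf
    have hco : ∀ k, fourierCoeffOn Real.two_pi_pos (fun θ => f θ j) k = 0 := by
      intro k
      have h1 : loopCoeff f k = 0 := by
        have := h k
        rw [integral_circleExp_smul] at this
        exact (smul_eq_zero.1 this).resolve_left (by positivity)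
      rw [loopCoeff, fourierCoeffOn_eq_integral] at h1
      have h2 := (smul_eq_zero.1 h1).resolve_left (by simp [Real.pi_ne_zero])
      rw [fourierCoeffOn_eq_integral]
      have hint : Integrable (fun θ : ℝ => (fourier (-k) (θ : AddCircle (2 * Real.pi - 0))) • f θ)
          circleMeasure := by
        refine (hf.integrable (by norm_num)).bdd_smul
          (φ := fun θ : ℝ => fourier (-k) (θ : AddCircle (2 * Real.pi - 0))) 1 ?_ ?_
        · exact ((map_continuous _).comp (AddCircle.continuous_mk' _)).aestronglyMeasurable
        · exact Eventually.of_forall fun θ => by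
            rw [fourier_apply, Circle.norm_coe]
      have h3 := (EuclideanSpace.proj (𝕜 := ℂ) j).integral_comp_comm hint
      rw [integral_circleMeasure, integral_circleMeasure, h2] at h3
      simp only [map_zero, map_smul] at h3
      rw [show (∫ x in (0:ℝ)..2 * Real.pi, fourier (-k) (x : AddCircle (2 * Real.pi - 0)) • f x j) = 0
        from h3, smul_zero]
    have hL2 : MemLp (fun θ => f θ j) 2 (volume.restrict (Set.Ioc 0 (2 * Real.pi))) := by
      rwa [← restrict_Ioo_eq_restrict_Ioc]
    have hs := hasSum_sq_fourierCoeffOn Real.two_pi_pos hL2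
    simp only [hco, norm_zero, ne_eq, OfNat.ofNat_ne_zero, not_false_eq_true, zero_pow] at hs
    have h0 := hs.unique hasSum_zero
    have h1 := (smul_eq_zero.1 h0).resolve_left (by simp [Real.pi_ne_zero])
    rw [← integral_circleMeasure, integral_eq_zero_iff_of_nonneg (fun _ => by positivity)
      hfj.integrable_norm_pow'] at h1
    filter_upwards [h1] with θ hθ
    simpa using hθ
  filter_upwards [ae_all_iff.2 key] with θ hθ
  ext j
  exact hθ j

/-! ### Fourier modes of maps on the cylinder -/

theorem ae_mem_cylMeasure (ε : ℝ) :
    ∀ᵐ p ∂(cylMeasure ε), p ∈ Set.Ioo 0 ε ×ˢ Set.Ioo 0 (2 * Real.pi) :=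
  ae_restrict_mem (measurableSet_Ioo.prod measurableSet_Ioo)

theorem exists_bound_cylMeasure {E : Type*} [NormedAddCommGroup E] {φ : ℝ × ℝ → E}
    (hφ : Continuous φ) (ε : ℝ) : ∃ C, ∀ᵐ p ∂(cylMeasure ε), ‖φ p‖ ≤ C := by
  obtain ⟨C, hC⟩ := (isCompact_Icc.prod isCompact_Icc :
    IsCompact (Set.Icc (0 : ℝ) ε ×ˢ Set.Icc 0 (2 * Real.pi))).exists_bound_of_continuousOn
    hφ.continuousOn
  refine ⟨C, ?_⟩
  filter_upwards [ae_mem_cylMeasure ε] with p hp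
  exact hC p ⟨Set.Ioo_subset_Icc_self hp.1, Set.Ioo_subset_Icc_self hp.2⟩

theorem memLp_cylMeasure_of_continuous {E : Type*} [NormedAddCommGroup E]
    [SecondCountableTopology E]
    {φ : ℝ × ℝ → E} (hφ : Continuous φ) (ε : ℝ) (q : ENNReal) : MemLp φ q (cylMeasure ε) := by
  obtain ⟨C, hC⟩ := exists_bound_cylMeasure hφ ε
  exact MemLp.of_bound hφ.aestronglyMeasurable C hC

theorem integrable_continuous_smul {𝕜 E : Type*} [NormedField 𝕜] [SecondCountableTopology 𝕜]
    [NormedAddCommGroup E]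
    [NormedSpace 𝕜 E] {ε : ℝ} {φ : ℝ × ℝ → 𝕜} (hφ : Continuous φ) {w : ℝ × ℝ → E}
    (hw : Integrable w (cylMeasure ε)) : Integrable (fun p => φ p • w p) (cylMeasure ε) := by
  obtain ⟨C, hC⟩ := exists_bound_cylMeasure hφ ε
  exact hw.bdd_smul C hφ.aestronglyMeasurable hC

theorem memLp_timeMeasure_of_continuous {E : Type*} [NormedAddCommGroup E]
    [SecondCountableTopology E]
    {φ : ℝ → E} (hφ : Continuous φ) (ε : ℝ) (q : ENNReal) : MemLp φ q (timeMeasure ε) := by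
  obtain ⟨C, hC⟩ := (isCompact_Icc (a := (0 : ℝ)) (b := ε)).exists_bound_of_continuousOn
    hφ.continuousOn
  refine MemLp.of_bound hφ.aestronglyMeasurable C ?_
  filter_upwards [ae_restrict_mem (measurableSet_Ioo (a := (0 : ℝ)) (b := ε))] with t ht
  exact hC t (Set.Ioo_subset_Icc_self ht)

theorem memLp_circleMeasure_of_continuous {E : Type*} [NormedAddCommGroup E]
    [SecondCountableTopology E]
    {φ : ℝ → E} (hφ : Continuous φ) (q : ENNReal) : MemLp φ q circleMeasure :=
  memLp_timeMeasure_of_continuous hφ (2 * Real.pi) q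

theorem integrable_continuous_smul_time {𝕜 E : Type*} [NormedField 𝕜] [SecondCountableTopology 𝕜]
    [NormedAddCommGroup E]
    [NormedSpace 𝕜 E] {ε : ℝ} {φ : ℝ → 𝕜} (hφ : Continuous φ) {w : ℝ → E}
    (hw : Integrable w (timeMeasure ε)) : Integrable (fun p => φ p • w p) (timeMeasure ε) := by
  obtain ⟨C, hC⟩ := (isCompact_Icc (a := (0 : ℝ)) (b := ε)).exists_bound_of_continuousOn
    hφ.continuousOn
  refine hw.bdd_smul C hφ.aestronglyMeasurable ?_
  filter_upwards [ae_restrict_mem (measurableSet_Ioo (a := (0 : ℝ)) (b := ε))] with t ht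
  exact hC t (Set.Ioo_subset_Icc_self ht)

/-- The `k`-th Fourier mode, in the circle direction, of a map on the cylinder. -/
def mode (w : ℝ × ℝ → Cn n) (k : ℤ) (t : ℝ) : Cn n :=
  ∫ θ, circleExp (-k) θ • w (t, θ) ∂circleMeasure

theorem integrable_mode {w : ℝ × ℝ → Cn n} (hw : Integrable w (cylMeasure ε)) (k : ℤ) :
    Integrable (mode w k) (timeMeasure ε) := by
  have h := integrable_continuous_smul ((continuous_circleExp (-k)).comp continuous_snd) hw
  rw [cylMeasure_eq_prod] at h
  exact h.integral_prod_left

theorem integral_smul_circleExp_smul {w : ℝ × ℝ → Cn n} (hw : Integrable w (cylMeasure ε)) (k : ℤ)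
    {χ : ℝ → ℝ} (hχ : Continuous χ) :
    ∫ p, χ p.1 • circleExp (-k) p.2 • w p ∂(cylMeasure ε) =
      ∫ t, χ t • mode w k t ∂(timeMeasure ε) := by
  have h := integrable_continuous_smul (hχ.comp continuous_fst)
    (integrable_continuous_smul ((continuous_circleExp (-k)).comp continuous_snd) hw)
  simp only [Function.comp_def] at h
  rw [cylMeasure_eq_prod] at h ⊢
  rw [integral_prod _ h]
  simp only [mode, integral_smul]

theorem ae_eq_zero_of_timeMeasure {g : ℝ → Cn n} (hg : Integrable g (timeMeasure ε))
    (h : ∀ χ : ℝ → ℝ, ContDiff ℝ ((⊤ : ℕ∞) : WithTop ℕ∞) χ →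
      tsupport χ ⊆ Set.Ioo 0 ε → ∫ t, χ t • g t ∂(timeMeasure ε) = 0) :
    g =ᵐ[timeMeasure ε] 0 := by
  have := isOpen_Ioo.ae_eq_zero_of_integral_contDiff_smul_eq_zero (U := Set.Ioo 0 ε)
    (f := g) (μ := volume) (IntegrableOn.locallyIntegrableOn hg) ?_
  · unfold timeMeasure
    rw [EventuallyEq, ae_restrict_iff' measurableSet_Ioo]
    exact this
  · intro χ hχ _ hsub
    rw [← h χ hχ hsub, timeMeasure, setIntegral_eq_integral_of_forall_compl_eq_zero]
    intro t ht
    rw [image_eq_zero_of_notMem_tsupport (fun h => ht (hsub h)), zero_smul]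

/-- By Fubini almost every slice $w(t,\cdot)$ is in $L^2$ and has all Fourier coefficients zero, so
completeness on the circle applies slice by slice. -/
theorem ae_eq_zero_of_mode {w : ℝ × ℝ → Cn n} (hw : MemLp w 2 (cylMeasure ε))
    (h : ∀ k, mode w k =ᵐ[timeMeasure ε] 0) : w =ᵐ[cylMeasure ε] 0 := by
  have hsq := hw.integrable_norm_pow'
  have hae := hw.aestronglyMeasurable
  rw [cylMeasure_eq_prod] at hsq hae ⊢
  have h2 := hae.prodMk_left
  have h3 : ∫ p, ‖w p‖ ^ 2 ∂((timeMeasure ε).prod circleMeasure) = 0 := by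
    rw [integral_prod _ hsq]
    refine integral_eq_zero_of_ae ?_
    filter_upwards [hsq.prod_right_ae, h2, ae_all_iff.2 h] with t ht1 ht2 ht3
    have hm : MemLp (fun θ => w (t, θ)) 2 circleMeasure :=
      (memLp_two_iff_integrable_sq_norm ht2).2 ht1
    refine integral_eq_zero_of_ae ?_
    filter_upwards [ae_eq_zero_of_circleExp hm ht3] with θ hθ
    simp [hθ]
  rw [integral_eq_zero_iff_of_nonneg (fun _ => by positivity) hsq] at h3
  filter_upwards [h3] with p hp
  simpa using hp

/-! ### The Hilbert sum decomposition into Fourier modes -/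

theorem memLp_circleExp_smul_fst {g : ℝ → Cn n} (hg : MemLp g 2 (timeMeasure ε)) (k : ℤ) :
    MemLp (fun p : ℝ × ℝ => circleExp k p.2 • g p.1) 2 (cylMeasure ε) := by
  rw [cylMeasure_eq_prod]
  have h := hg.comp_fst circleMeasure
  refine MemLp.of_le_mul (c := (Real.sqrt (2 * Real.pi))⁻¹) h ?_ ?_
  · exact (((continuous_circleExp k).comp continuous_snd).aestronglyMeasurable).smul h.1
  · exact Eventually.of_forall fun p => by rw [norm_smul, norm_circleExp]

theorem ae_cylMeasure_of_ae_timeMeasure {P : ℝ → Prop} (h : ∀ᵐ t ∂(timeMeasure ε), P t) :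
    ∀ᵐ p ∂(cylMeasure ε), P p.1 := by
  rw [cylMeasure_eq_prod]
  exact Measure.quasiMeasurePreserving_fst.ae h

/-- The linear map `g ↦ e_k(θ) g(t)`. -/
def modeEmbLinear (n : ℕ) (ε : ℝ) (k : ℤ) :
    Lp (Cn n) 2 (timeMeasure ε) →ₗ[ℂ] Lp (Cn n) 2 (cylMeasure ε) where
  toFun g := (memLp_circleExp_smul_fst (Lp.memLp g) k).toLp _
  map_add' g h := by
    rw [← MemLp.toLp_add]
    refine MemLp.toLp_congr _ _ ?_
    filter_upwards [ae_cylMeasure_of_ae_timeMeasure (Lp.coeFn_add g h)] with p hp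
    simp only [hp, Pi.add_apply, smul_add]
  map_smul' c g := by
    rw [RingHom.id_apply, ← MemLp.toLp_const_smul]
    refine MemLp.toLp_congr _ _ ?_
    filter_upwards [ae_cylMeasure_of_ae_timeMeasure (Lp.coeFn_smul c g)] with p hp
    simp [hp, smul_comm c]

theorem coeFn_modeEmbLinear (k : ℤ) (g : Lp (Cn n) 2 (timeMeasure ε)) :
    modeEmbLinear n ε k g =ᵐ[cylMeasure ε] fun p => circleExp k p.2 • g p.1 :=
  MemLp.coeFn_toLp (memLp_circleExp_smul_fst (Lp.memLp g) k)

theorem inner_modeEmbLinear (j k : ℤ) (g h : Lp (Cn n) 2 (timeMeasure ε)) :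
    inner ℂ (modeEmbLinear n ε j g) (modeEmbLinear n ε k h) =
      if j = k then inner ℂ g h else 0 := by
  rw [L2.inner_def, L2.inner_def]
  have h1 : ∫ p, inner ℂ (modeEmbLinear n ε j g p) (modeEmbLinear n ε k h p) ∂(cylMeasure ε) =
      ∫ p : ℝ × ℝ, inner ℂ (g p.1) (h p.1) * (circleExp (-j) p.2 * circleExp k p.2)
        ∂(cylMeasure ε) := by
    refine integral_congr_ae ?_
    filter_upwards [coeFn_modeEmbLinear j g, coeFn_modeEmbLinear k h] with p hp hq
    rw [hp, hq, inner_smul_left, inner_smul_right, conj_circleExp]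
    ring
  rw [h1, cylMeasure_eq_prod, integral_prod_mul (fun t => inner ℂ (g t) (h t))
    (fun θ => circleExp (-j) θ * circleExp k θ), integral_circleExp_mul]
  split_ifs <;> simp

/-- The isometric embedding `g ↦ e_k(θ) g(t)`. -/
def modeEmb (n : ℕ) (ε : ℝ) (k : ℤ) :
    Lp (Cn n) 2 (timeMeasure ε) →ₗᵢ[ℂ] Lp (Cn n) 2 (cylMeasure ε) :=
  (modeEmbLinear n ε k).isometryOfInner fun g h => by simp [inner_modeEmbLinear]

theorem coeFn_modeEmb (k : ℤ) (g : Lp (Cn n) 2 (timeMeasure ε)) :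
    modeEmb n ε k g =ᵐ[cylMeasure ε] fun p => circleExp k p.2 • g p.1 :=
  coeFn_modeEmbLinear k g

theorem orthogonalFamily_modeEmb (n : ℕ) (ε : ℝ) :
    OrthogonalFamily ℂ (fun _ : ℤ => Lp (Cn n) 2 (timeMeasure ε)) (modeEmb n ε) := by
  intro j k hjk g h
  exact (inner_modeEmbLinear j k g h).trans (if_neg hjk)

/-- It suffices to take $g=\chi v$ with $\chi$ a smooth cutoff in $t$ and $v$ a constant vector:
these pairings determine the mode as a distribution. -/
theorem mode_eq_zero_of_inner_modeEmb {w : Lp (Cn n) 2 (cylMeasure ε)} {k : ℤ}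
    (h : ∀ g, inner ℂ (modeEmb n ε k g) w = 0) : mode w k =ᵐ[timeMeasure ε] 0 := by
  have hw : Integrable w (cylMeasure ε) := (Lp.memLp w).integrable (by norm_num)
  refine ae_eq_zero_of_timeMeasure (integrable_mode hw k) fun χ hχ _ => ?_
  rw [← integral_smul_circleExp_smul hw k hχ.continuous]
  have hint := integrable_continuous_smul (hχ.continuous.comp continuous_fst)
    (integrable_continuous_smul ((continuous_circleExp (-k)).comp continuous_snd) hw)
  simp only [Function.comp_def] at hint
  refine ext_inner_left ℂ fun v => ?_
  rw [inner_zero_right, ← integral_inner hint v]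
  have hg : MemLp (fun t => (χ t) • v) 2 (timeMeasure ε) :=
    memLp_timeMeasure_of_continuous (hχ.continuous.smul continuous_const) ε 2
  rw [← h (hg.toLp _), L2.inner_def]
  refine integral_congr_ae ?_
  filter_upwards [coeFn_modeEmb k (hg.toLp _),
    ae_cylMeasure_of_ae_timeMeasure hg.coeFn_toLp] with p hp hq
  rw [hp, hq, inner_smul_left, conj_circleExp]
  simp only [← Complex.coe_smul, inner_smul_left, inner_smul_right, Complex.conj_ofReal]
  ring

theorem isHilbertSum_modeEmb (n : ℕ) (ε : ℝ) :
    IsHilbertSum ℂ (fun _ : ℤ => Lp (Cn n) 2 (timeMeasure ε)) (modeEmb n ε) := by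
  refine IsHilbertSum.mk (orthogonalFamily_modeEmb n ε) ?_
  rw [top_le_iff, Submodule.topologicalClosure_eq_top_iff, Submodule.eq_bot_iff]
  intro w hw
  refine (Lp.eq_zero_iff_ae_eq_zero).2 (ae_eq_zero_of_mode (Lp.memLp w) fun k => ?_)
  refine mode_eq_zero_of_inner_modeEmb fun g => ?_
  exact (Submodule.mem_orthogonal _ _).1 hw _
    ((le_iSup (fun i => LinearMap.range (modeEmb n ε i).toLinearMap) k) ⟨g, rfl⟩)

/-- The linear map `v ↦ e_k(θ) v`. -/
def loopEmbLinear (n : ℕ) (k : ℤ) : Cn n →ₗ[ℂ] Lp (Cn n) 2 circleMeasure where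
  toFun v := (memLp_circleMeasure_of_continuous
    ((continuous_circleExp k).smul continuous_const) 2).toLp (fun θ => circleExp k θ • v)
  map_add' v w := by
    rw [← MemLp.toLp_add]
    exact MemLp.toLp_congr _ _ (Eventually.of_forall fun θ => by simp)
  map_smul' c v := by
    rw [RingHom.id_apply, ← MemLp.toLp_const_smul]
    exact MemLp.toLp_congr _ _ (Eventually.of_forall fun θ => by simp [smul_comm c])

theorem coeFn_loopEmbLinear (k : ℤ) (v : Cn n) :
    loopEmbLinear n k v =ᵐ[circleMeasure] fun θ => circleExp k θ • v :=
  MemLp.coeFn_toLp (memLp_circleMeasure_of_continuous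
    ((continuous_circleExp k).smul continuous_const) 2)

theorem inner_loopEmbLinear (j k : ℤ) (v w : Cn n) :
    inner ℂ (loopEmbLinear n j v) (loopEmbLinear n k w) = if j = k then inner ℂ v w else 0 := by
  rw [L2.inner_def]
  have h1 : ∫ θ, inner ℂ (loopEmbLinear n j v θ) (loopEmbLinear n k w θ) ∂circleMeasure =
      ∫ θ, (circleExp (-j) θ * circleExp k θ) * inner ℂ v w ∂circleMeasure := by
    refine integral_congr_ae ?_
    filter_upwards [coeFn_loopEmbLinear j v, coeFn_loopEmbLinear k w] with θ hp hq
    rw [hp, hq, inner_smul_left, inner_smul_right, conj_circleExp]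
    ring
  rw [h1, integral_mul_const, integral_circleExp_mul]
  split_ifs <;> simp

/-- The isometric embedding `v ↦ e_k(θ) v`. -/
def loopEmb (n : ℕ) (k : ℤ) : Cn n →ₗᵢ[ℂ] Lp (Cn n) 2 circleMeasure :=
  (loopEmbLinear n k).isometryOfInner fun v w => by simp [inner_loopEmbLinear]

theorem coeFn_loopEmb (k : ℤ) (v : Cn n) :
    loopEmb n k v =ᵐ[circleMeasure] fun θ => circleExp k θ • v :=
  coeFn_loopEmbLinear k v

theorem orthogonalFamily_loopEmb (n : ℕ) :
    OrthogonalFamily ℂ (fun _ : ℤ => Cn n) (loopEmb n) := by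
  intro j k hjk v w
  exact (inner_loopEmbLinear j k v w).trans (if_neg hjk)

theorem inner_loopEmb (k : ℤ) (v : Cn n) (f : Lp (Cn n) 2 circleMeasure) :
    inner ℂ (loopEmb n k v) f = inner ℂ v (∫ θ, circleExp (-k) θ • f θ ∂circleMeasure) := by
  rw [L2.inner_def, ← integral_inner (integrable_circleExp_smul
    ((Lp.memLp f).integrable (by norm_num)) (-k)) v]
  refine integral_congr_ae ?_
  filter_upwards [coeFn_loopEmb k v] with θ hθ
  rw [hθ, inner_smul_left, inner_smul_right, conj_circleExp]

/-- The weight $|k|$ is at least $1$ except at $k=0$, and that single term is added by hand. -/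
theorem MemLHalf.summable_sq {b : ℝ → Cn n} (hb : MemLHalf b) :
    Summable fun k => ‖loopCoeff b k‖ ^ 2 := by
  refine Summable.of_nonneg_of_le (fun _ => by positivity) (fun k => ?_)
    (hb.2.add (hasSum_ite_eq 0 (‖loopCoeff b 0‖ ^ 2)).summable)
  by_cases hk : k = 0
  · simp [hk]
  · have h1 : (1 : ℝ) ≤ |(k : ℝ)| := by exact_mod_cast Int.one_le_abs hk
    simp only [hk, if_false, add_zero]
    exact le_mul_of_one_le_left (by positivity) h1

theorem integral_circleExp_smul_of_hasSum {y : ℤ → Cn n} {f : Lp (Cn n) 2 circleMeasure}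
    (hf : HasSum (fun k => loopEmb n k (y k)) f) (k : ℤ) :
    ∫ θ, circleExp (-k) θ • f θ ∂circleMeasure = y k := by
  refine ext_inner_left ℂ fun v => ?_
  rw [← inner_loopEmb]
  have h := (innerSL ℂ (loopEmb n k v)).hasSum hf
  refine h.unique ?_
  have h2 := hasSum_single (f := fun j => innerSL ℂ (loopEmb n k v) (loopEmb n j (y j))) k
    (fun j hj => orthogonalFamily_loopEmb n hj.symm v (y j))
  simpa using h2

theorem hasSum_of_summable_sq {ι : Type*} {G : Type*} {X : Type*} [NormedAddCommGroup G]
    [InnerProductSpace ℂ G] [NormedAddCommGroup X] [InnerProductSpace ℂ X] [CompleteSpace X]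
    {V : ι → G →ₗᵢ[ℂ] X} (hV : OrthogonalFamily ℂ (fun _ : ι => G) V) {y : ι → G}
    (hy : Summable fun k => ‖y k‖ ^ 2) :
    ∃ x, HasSum (fun k => V k (y k)) x ∧ ‖x‖ ^ 2 = ∑' k, ‖y k‖ ^ 2 := by
  have hm : Memℓp y 2 := memℓp_gen (by simpa using hy)
  refine ⟨hV.linearIsometry ⟨y, hm⟩, hV.hasSum_linearIsometry ⟨y, hm⟩, ?_⟩
  rw [LinearIsometry.norm_map]
  have := lp.norm_rpow_eq_tsum (p := 2) (by norm_num) (⟨y, hm⟩ : lp (fun _ : ι => G) 2)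
  simpa using this

theorem exists_hasSum_modeEmb (F : Lp (Cn n) 2 (cylMeasure ε)) :
    ∃ f : ℤ → Lp (Cn n) 2 (timeMeasure ε), HasSum (fun k => modeEmb n ε k (f k)) F ∧
      HasSum (fun k => ‖f k‖ ^ 2) (‖F‖ ^ 2) := by
  obtain ⟨w, rfl⟩ := (isHilbertSum_modeEmb n ε).linearIsometryEquiv.symm.surjective F
  refine ⟨fun k => w k, (isHilbertSum_modeEmb n ε).hasSum_linearIsometryEquiv_symm w, ?_⟩
  rw [LinearIsometryEquiv.norm_map]
  have := lp.hasSum_norm (p := 2) (by norm_num) w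
  simpa using this

/-! ### The ordinary differential equation of a Fourier mode -/

theorem ae_mem_timeMeasure (ε : ℝ) : ∀ᵐ t ∂(timeMeasure ε), t ∈ Set.Ioo 0 ε :=
  ae_restrict_mem measurableSet_Ioo

theorem intervalIntegrable_of_timeMeasure {E : Type*} [NormedAddCommGroup E] (hε : 0 ≤ ε)
    {h : ℝ → E} (hh : Integrable h (timeMeasure ε)) : IntervalIntegrable h volume 0 ε := by
  rw [intervalIntegrable_iff_integrableOn_Ioo_of_le hε]
  exact hh

theorem setIntegral_Iio_timeMeasure (h : ℝ → Cn n) {t : ℝ} (ht : t ∈ Set.Ioo 0 ε) :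
    ∫ s, (Set.Iio t).indicator h s ∂(timeMeasure ε) = ∫ s in (0 : ℝ)..t, h s := by
  rw [integral_indicator measurableSet_Iio, timeMeasure, Measure.restrict_restrict measurableSet_Iio,
    intervalIntegral.integral_of_le ht.1.le, integral_Ioc_eq_integral_Ioo]
  congr 2
  ext s
  simp only [Set.mem_inter_iff, Set.mem_Iio, Set.mem_Ioo]
  constructor
  · rintro ⟨h1, h2, -⟩; exact ⟨h2, h1⟩
  · rintro ⟨h1, h2⟩; exact ⟨h2, h1, h2.trans ht.2⟩

theorem setIntegral_Ioi_timeMeasure (h : ℝ → ℝ) {s : ℝ} (hs : s ∈ Set.Ioo 0 ε) :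
    ∫ t, (Set.Ioi s).indicator h t ∂(timeMeasure ε) = ∫ t in s..ε, h t := by
  rw [integral_indicator measurableSet_Ioi, timeMeasure, Measure.restrict_restrict measurableSet_Ioi,
    intervalIntegral.integral_of_le hs.2.le, integral_Ioc_eq_integral_Ioo]
  congr 2
  ext t
  simp only [Set.mem_inter_iff, Set.mem_Ioi, Set.mem_Ioo]
  constructor
  · rintro ⟨h1, -, h2⟩; exact ⟨h1, h2⟩
  · rintro ⟨h1, h2⟩; exact ⟨h1, hs.1.trans h1, h2⟩

/-- Integration by parts against the primitive of an integrable function. -/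
theorem integral_deriv_smul_primitive (hε : 0 < ε) {Φ : ℝ → ℝ} (hΦ : ContDiff ℝ 1 Φ)
    {h : ℝ → Cn n} (hh : Integrable h (timeMeasure ε)) (y : Cn n) :
    ∫ t, (deriv Φ t • (y + ∫ s in (0 : ℝ)..t, h s) + Φ t • h t) ∂(timeMeasure ε) =
      Φ ε • (y + ∫ s in (0 : ℝ)..ε, h s) - Φ 0 • y := by
  have hd : Continuous (deriv Φ) := hΦ.continuous_deriv le_rfl
  have hdi : Integrable (deriv Φ) (timeMeasure ε) :=
    memLp_one_iff_integrable.1 (memLp_timeMeasure_of_continuous hd ε 1)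
  have hΦh : Integrable (fun t => Φ t • h t) (timeMeasure ε) :=
    integrable_continuous_smul_time hΦ.continuous hh
  have hftc : ∀ a b : ℝ, ∫ t in a..b, deriv Φ t = Φ b - Φ a := fun a b =>
    intervalIntegral.integral_deriv_eq_sub
      (fun t _ => (hΦ.differentiable (by norm_num)).differentiableAt) (hd.intervalIntegrable _ _)
  have hprod : Integrable (Function.uncurry fun t s : ℝ => deriv Φ t • (Set.Iio t).indicator h s)
      ((timeMeasure ε).prod (timeMeasure ε)) := by
    have h1 := (Integrable.smul_prod hdi hh).indicator
      (measurableSet_lt measurable_snd measurable_fst : MeasurableSet {p : ℝ × ℝ | p.2 < p.1})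
    refine h1.congr (Eventually.of_forall fun p => ?_)
    simp only [Function.uncurry, Set.indicator_apply, Set.mem_ofPred_eq, Set.mem_Iio]
    split_ifs <;> simp
  have hA : ∀ᵐ t ∂(timeMeasure ε), deriv Φ t • (∫ s in (0 : ℝ)..t, h s) =
      ∫ s, deriv Φ t • (Set.Iio t).indicator h s ∂(timeMeasure ε) := by
    filter_upwards [ae_mem_timeMeasure ε] with t ht
    rw [integral_smul, setIntegral_Iio_timeMeasure h ht]
  have hint : Integrable (fun t => deriv Φ t • (∫ s in (0 : ℝ)..t, h s)) (timeMeasure ε) :=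
    hprod.integral_prod_left.congr (hA.mono fun t ht => ht.symm)
  -- Fubini on the triangle $s<t$ replaces the product rule, since `h` is merely integrable.
  have hswap : ∫ t, deriv Φ t • (∫ s in (0 : ℝ)..t, h s) ∂(timeMeasure ε) =
      ∫ s, (Φ ε - Φ s) • h s ∂(timeMeasure ε) := by
    rw [integral_congr_ae hA, integral_integral_swap hprod]
    refine integral_congr_ae ?_
    filter_upwards [ae_mem_timeMeasure ε] with s hs
    rw [← hftc s ε, ← setIntegral_Ioi_timeMeasure (deriv Φ) hs, ← integral_smul_const]
    refine integral_congr_ae (Eventually.of_forall fun t => ?_)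
    simp only [Set.indicator_apply, Set.mem_Iio, Set.mem_Ioi]
    split_ifs <;> simp
  simp only [smul_add]
  rw [integral_add _ hΦh, integral_add (hdi.smul_const y) hint, hswap, integral_smul_const,
    integral_timeMeasure hε.le (deriv Φ), hftc]
  · simp only [sub_smul]
    have hc : Integrable (fun t => Φ ε • h t) (timeMeasure ε) := hh.smul (Φ ε)
    rw [integral_sub hc hΦh, integral_smul, integral_timeMeasure hε.le h]
    abel
  · exact (hdi.smul_const y).add hint

/-! ### $L^2$ norms and the Schur test for the exponential kernel. -/

theorem norm_sq_eq_integral {α E : Type*} [MeasurableSpace α] {μ : Measure α}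
    [NormedAddCommGroup E] [InnerProductSpace ℂ E] (f : Lp E 2 μ) :
    ‖f‖ ^ 2 = ∫ x, ‖f x‖ ^ 2 ∂μ := by
  have h := L2.inner_def (𝕜 := ℂ) f f
  simp only [inner_self_eq_norm_sq_to_K] at h
  rw [← Complex.ofReal_inj]
  push_cast
  rw [← integral_complex_ofReal]
  simpa using h

theorem norm_sq_toLp_eq_integral {α E : Type*} [MeasurableSpace α] {μ : Measure α}
    [NormedAddCommGroup E] [InnerProductSpace ℂ E] {f : α → E} (hf : MemLp f 2 μ) :
    ‖hf.toLp f‖ ^ 2 = ∫ x, ‖f x‖ ^ 2 ∂μ := by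
  rw [norm_sq_eq_integral]
  refine integral_congr_ae ?_
  filter_upwards [hf.coeFn_toLp] with x hx
  rw [hx]

/-- The exponential kernel of the mode equation. -/
def expKernel (κ : ℝ) (t s : ℝ) : ℝ := Real.exp (-(κ * |t - s|))

theorem continuous_expKernel (κ : ℝ) : Continuous fun p : ℝ × ℝ => expKernel κ p.1 p.2 := by
  unfold expKernel; fun_prop

theorem expKernel_symm (κ t s : ℝ) : expKernel κ t s = expKernel κ s t := by
  unfold expKernel; rw [abs_sub_comm]

theorem expKernel_pos (κ t s : ℝ) : 0 < expKernel κ t s := Real.exp_pos _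

theorem expKernel_le_one {κ : ℝ} (hκ : 0 ≤ κ) (t s : ℝ) : expKernel κ t s ≤ 1 :=
  Real.exp_le_one_iff.2 (neg_nonpos.2 (mul_nonneg hκ (abs_nonneg _)))

theorem integral_expKernel_le_length (hε : 0 ≤ ε) {κ : ℝ} (hκ : 0 ≤ κ) (t : ℝ) :
    ∫ s, expKernel κ t s ∂(timeMeasure ε) ≤ ε := by
  have h := norm_integral_le_of_norm_le_const (μ := timeMeasure ε) (C := 1)
    (f := fun s => expKernel κ t s) (Eventually.of_forall fun s => by
      rw [Real.norm_of_nonneg (expKernel_pos _ _ _).le]; exact expKernel_le_one hκ t s)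
  have h2 : (timeMeasure ε).real Set.univ = ε := by
    simp [timeMeasure, Measure.real, hε]
  rw [h2, one_mul] at h
  exact (le_abs_self _).trans h

theorem integral_expKernel_le_inv {κ : ℝ} (hκ : 0 < κ) (t : ℝ) :
    ∫ s, expKernel κ t s ∂(timeMeasure ε) ≤ 2 / κ := by
  have h0 : ∫ s, Real.exp (-(κ * |s|)) = 2 / κ := by
    rw [integral_comp_abs (f := fun x => Real.exp (-(κ * x)))]
    simp only [← neg_mul]
    rw [integral_exp_mul_Ioi (neg_neg_of_pos hκ)]
    simp
    field_simp
  have h1 : ∫ s, expKernel κ t s = 2 / κ := by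
    rw [← h0]
    exact integral_sub_left_eq_self (fun s => Real.exp (-(κ * |s|))) volume t
  rw [← h1]
  refine setIntegral_le_integral ?_ (Eventually.of_forall fun s => (expKernel_pos _ _ _).le)
  -- The Bochner integral of a non-integrable function is $0$, so the nonzero value $2/\kappa$
  -- already proves integrability.
  refine Integrable.of_integral_ne_zero ?_
  rw [h1]; positivity

theorem integrable_expKernel_mul (κ t : ℝ) {f : ℝ → ℝ} (hf : Integrable f (timeMeasure ε)) :
    Integrable (fun s => expKernel κ t s * f s) (timeMeasure ε) :=
  integrable_continuous_smul_time
    ((continuous_expKernel κ).comp (Continuous.prodMk_right t)) hf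

theorem integrable_expKernel (κ t : ℝ) : Integrable (expKernel κ t) (timeMeasure ε) :=
  memLp_one_iff_integrable.1 (memLp_timeMeasure_of_continuous
    ((continuous_expKernel κ).comp (Continuous.prodMk_right t)) ε 1)

/-- Cauchy–Schwarz for the measure $e^{-\kappa|t-s|}ds$ of mass at most $A$, obtained by expanding
the nonnegative integral of $(f-m/A)^2$, where $m$ is the integral of $f$. -/
theorem sq_integral_expKernel_mul_le {κ A : ℝ} (hA : 0 < A) {t : ℝ}
    (hK : ∫ s, expKernel κ t s ∂(timeMeasure ε) ≤ A) {f : ℝ → ℝ} (hf : MemLp f 2 (timeMeasure ε)) :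
    (∫ s, expKernel κ t s * f s ∂(timeMeasure ε)) ^ 2 ≤
      A * ∫ s, expKernel κ t s * f s ^ 2 ∂(timeMeasure ε) := by
  set m := ∫ s, expKernel κ t s * f s ∂(timeMeasure ε) with hm
  have i1 := integrable_expKernel_mul κ t (hf.integrable (by norm_num))
  have i2 := integrable_expKernel_mul κ t hf.integrable_sq
  have i3 := integrable_expKernel (ε := ε) κ t
  have h0 : 0 ≤ ∫ s, expKernel κ t s * (f s - m / A) ^ 2 ∂(timeMeasure ε) :=
    integral_nonneg fun s => mul_nonneg (expKernel_pos _ _ _).le (sq_nonneg _)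
  have h1 : ∫ s, expKernel κ t s * (f s - m / A) ^ 2 ∂(timeMeasure ε) =
      ∫ s, expKernel κ t s * f s ^ 2 ∂(timeMeasure ε) - 2 * (m / A) * m +
        (m / A) ^ 2 * ∫ s, expKernel κ t s ∂(timeMeasure ε) := by
    have e1 : Integrable (fun s => 2 * (m / A) * (expKernel κ t s * f s)) (timeMeasure ε) :=
      i1.const_mul _
    have e2 : Integrable (fun s => expKernel κ t s * f s ^ 2 -
        2 * (m / A) * (expKernel κ t s * f s)) (timeMeasure ε) := i2.sub e1
    have e3 : Integrable (fun s => (m / A) ^ 2 * expKernel κ t s) (timeMeasure ε) := i3.const_mul _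
    rw [hm, ← integral_const_mul, ← integral_const_mul, ← hm, ← integral_sub i2 e1,
      ← integral_add e2 e3]
    congr 1; ext s; ring
  have h2 : (m / A) ^ 2 * ∫ s, expKernel κ t s ∂(timeMeasure ε) ≤ (m / A) ^ 2 * A :=
    mul_le_mul_of_nonneg_left hK (sq_nonneg _)
  have h3 : m ^ 2 / A ≤ ∫ s, expKernel κ t s * f s ^ 2 ∂(timeMeasure ε) := by
    have e1 : 2 * (m / A) * m = 2 * (m ^ 2 / A) := by ring
    have e2 : (m / A) ^ 2 * A = m ^ 2 / A := by field_simp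
    linarith
  rwa [div_le_iff₀' hA] at h3

theorem integrable_expKernel_mul_prod (κ : ℝ) {f : ℝ → ℝ} (hf : Integrable f (timeMeasure ε)) :
    Integrable (Function.uncurry fun t s : ℝ => expKernel κ t s * f s)
      ((timeMeasure ε).prod (timeMeasure ε)) := by
  have h1 : Integrable (fun p : ℝ × ℝ => f p.2) ((timeMeasure ε).prod (timeMeasure ε)) := by
    simpa using (integrable_const (1 : ℝ)).mul_prod hf
  obtain ⟨C, hC⟩ := (isCompact_Icc.prod isCompact_Icc :
    IsCompact (Set.Icc (0 : ℝ) ε ×ˢ Set.Icc 0 ε)).exists_bound_of_continuousOn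
    (continuous_expKernel κ).continuousOn
  refine h1.bdd_mul (c := C) (continuous_expKernel κ).aestronglyMeasurable ?_
  filter_upwards [Measure.quasiMeasurePreserving_fst.ae (ae_mem_timeMeasure ε),
    Measure.quasiMeasurePreserving_snd.ae (ae_mem_timeMeasure ε)] with p hp hq
  exact hC p ⟨Set.Ioo_subset_Icc_self hp, Set.Ioo_subset_Icc_self hq⟩

/-- The Schur test for the exponential kernel. -/
theorem integral_sq_integral_expKernel_mul_le {κ A : ℝ} (hA : 0 < A)
    (hK : ∀ t, ∫ s, expKernel κ t s ∂(timeMeasure ε) ≤ A) {f : ℝ → ℝ}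
    (hf : MemLp f 2 (timeMeasure ε)) :
    ∫ t, (∫ s, expKernel κ t s * f s ∂(timeMeasure ε)) ^ 2 ∂(timeMeasure ε) ≤
      A ^ 2 * ∫ s, f s ^ 2 ∂(timeMeasure ε) := by
  have hp := integrable_expKernel_mul_prod κ hf.integrable_sq
  have hp1 := integrable_expKernel_mul_prod κ (hf.integrable (by norm_num))
  have hmain : ∫ t, (∫ s, expKernel κ t s * f s ∂(timeMeasure ε)) ^ 2 ∂(timeMeasure ε) ≤
      ∫ t, A * ∫ s, expKernel κ t s * f s ^ 2 ∂(timeMeasure ε) ∂(timeMeasure ε) :=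
    integral_mono_of_nonneg (Eventually.of_forall fun t => sq_nonneg _)
      (hp.integral_prod_left.const_mul A)
      (Eventually.of_forall fun t => sq_integral_expKernel_mul_le hA (hK t) hf)
  refine hmain.trans ?_
  rw [integral_const_mul, integral_integral_swap hp, sq, mul_assoc,
    ← integral_const_mul A (fun s => f s ^ 2)]
  refine mul_le_mul_of_nonneg_left ?_ hA.le
  refine integral_mono hp.integral_prod_right (hf.integrable_sq.const_mul A) fun s => ?_
  simp only
  rw [integral_mul_const]
  refine mul_le_mul_of_nonneg_right ?_ (sq_nonneg _)
  -- The kernel is symmetric, so the bound on its rows also bounds its columns.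
  simp only [expKernel_symm κ _ s]
  exact hK s

/-- The solution of `s' = k s + F`, `s τ = y`. -/
def modeSol (k : ℝ) (τ : ℝ) (y : Cn n) (F : ℝ → Cn n) (t : ℝ) : Cn n :=
  Real.exp (k * (t - τ)) • y + ∫ s in τ..t, Real.exp (k * (t - s)) • F s

theorem modeSol_self (k τ : ℝ) (y : Cn n) (F : ℝ → Cn n) : modeSol k τ y F τ = y := by
  simp [modeSol]

/-- With the integrating factor $e^{kt}$ pulled out, what remains is a constant plus a primitive
based at $0$, whatever $\tau$ is. Continuity and integration by parts then follow from the case of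
primitives. -/
theorem modeSol_eq_exp_smul (hε : 0 ≤ ε) (k : ℝ) {τ : ℝ} (hτ : τ ∈ Set.Icc 0 ε) (y : Cn n)
    {F : ℝ → Cn n} (hF : Integrable F (timeMeasure ε)) {t : ℝ} (ht : t ∈ Set.Icc 0 ε) :
    modeSol k τ y F t = Real.exp (k * t) •
      ((Real.exp (-(k * τ)) • y + ∫ s in τ..(0 : ℝ), Real.exp (-(k * s)) • F s) +
        ∫ s in (0 : ℝ)..t, Real.exp (-(k * s)) • F s) := by
  have hi := intervalIntegrable_of_timeMeasure hε (integrable_continuous_smul_time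
    (φ := fun s => Real.exp (-(k * s))) (by fun_prop) hF)
  have hsub : ∀ a ∈ Set.Icc 0 ε, ∀ b ∈ Set.Icc 0 ε,
      IntervalIntegrable (fun s => Real.exp (-(k * s)) • F s) volume a b := fun a ha b hb =>
    hi.mono_set (Set.uIcc_subset_uIcc (by rwa [Set.uIcc_of_le hε]) (by rwa [Set.uIcc_of_le hε]))
  rw [add_assoc, intervalIntegral.integral_add_adjacent_intervals
    (hsub τ hτ 0 ⟨le_rfl, hε⟩) (hsub 0 ⟨le_rfl, hε⟩ t ht), smul_add, smul_smul, ← Real.exp_add,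
    ← intervalIntegral.integral_smul, modeSol]
  congr 1
  · congr 2; ring
  · refine intervalIntegral.integral_congr fun s _ => ?_
    simp only [smul_smul, ← Real.exp_add]
    congr 2; ring

theorem continuousOn_modeSol (hε : 0 ≤ ε) (k : ℝ) {τ : ℝ} (hτ : τ ∈ Set.Icc 0 ε) (y : Cn n)
    {F : ℝ → Cn n} (hF : Integrable F (timeMeasure ε)) :
    ContinuousOn (modeSol k τ y F) (Set.Icc 0 ε) := by
  have hi := intervalIntegrable_of_timeMeasure hε (integrable_continuous_smul_time
    (φ := fun s => Real.exp (-(k * s))) (by fun_prop) hF)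
  have hc := intervalIntegral.continuousOn_primitive_interval' hi (Set.left_mem_uIcc)
  rw [Set.uIcc_of_le hε] at hc
  refine ContinuousOn.congr ?_ fun t ht => modeSol_eq_exp_smul hε k hτ y hF ht
  exact ContinuousOn.smul (f := fun t => Real.exp (k * t)) (by fun_prop) (continuousOn_const.add hc)

theorem memLp_of_continuousOn_Icc {f : ℝ → Cn n} (hf : ContinuousOn f (Set.Icc 0 ε)) :
    MemLp f 2 (timeMeasure ε) := by
  obtain ⟨C, hC⟩ := (isCompact_Icc (a := (0 : ℝ)) (b := ε)).exists_bound_of_continuousOn hf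
  refine MemLp.of_bound ((hf.mono Set.Ioo_subset_Icc_self).aestronglyMeasurable
    measurableSet_Ioo) C ?_
  filter_upwards [ae_mem_timeMeasure ε] with t ht
  exact hC t (Set.Ioo_subset_Icc_self ht)

/-- The weak form of $s'=ks+F$ with boundary terms: moving $e^{kt}$ onto the test function,
$\Phi=\varphi e^{kt}$, reduces it to `integral_deriv_smul_primitive`. -/
theorem integral_deriv_smul_modeSol (hε : 0 < ε) (k : ℝ) {τ : ℝ} (hτ : τ ∈ Set.Icc 0 ε) (y : Cn n)
    {F : ℝ → Cn n} (hF : Integrable F (timeMeasure ε)) {φ : ℝ → ℝ} (hφ : ContDiff ℝ 1 φ) :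
    ∫ t, (deriv φ t • modeSol k τ y F t + φ t • (k • modeSol k τ y F t + F t)) ∂(timeMeasure ε) =
      φ ε • modeSol k τ y F ε - φ 0 • modeSol k τ y F 0 := by
  have hΦ : ContDiff ℝ 1 fun t => φ t * Real.exp (k * t) := by fun_prop
  have hh : Integrable (fun s => Real.exp (-(k * s)) • F s) (timeMeasure ε) :=
    integrable_continuous_smul_time (by fun_prop) hF
  have h := integral_deriv_smul_primitive hε hΦ hh
    (Real.exp (-(k * τ)) • y + ∫ s in τ..(0 : ℝ), Real.exp (-(k * s)) • F s)
  rw [modeSol_eq_exp_smul hε.le k hτ y hF ⟨hε.le, le_rfl⟩,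
    modeSol_eq_exp_smul hε.le k hτ y hF ⟨le_rfl, hε.le⟩, smul_smul, smul_smul]
  simp only [intervalIntegral.integral_same, add_zero]
  rw [← h]
  refine integral_congr_ae ?_
  filter_upwards [ae_mem_timeMeasure ε] with t ht
  have hd : deriv (fun t => φ t * Real.exp (k * t)) t =
      deriv φ t * Real.exp (k * t) + φ t * (k * Real.exp (k * t)) := by
    have h1 : HasDerivAt φ (deriv φ t) t :=
      ((hφ.differentiable (by norm_num)).differentiableAt).hasDerivAt
    have h2 : HasDerivAt (fun t => Real.exp (k * t)) (k * Real.exp (k * t)) t := by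
      have := (((hasDerivAt_id t).const_mul k).exp)
      simpa [mul_comm] using this
    exact (h1.mul h2).deriv
  rw [modeSol_eq_exp_smul hε.le k hτ y hF (Set.Ioo_subset_Icc_self ht), hd]
  have hexp : Real.exp (k * t) * Real.exp (-(k * t)) = 1 := by rw [← Real.exp_add]; simp
  have h3 : (φ t * Real.exp (k * t)) • Real.exp (-(k * t)) • F t = φ t • F t := by
    rw [smul_smul, mul_assoc, hexp, mul_one]
  rw [h3]
  module

/-- The initial time of a mode: the left end for the nonnegative spectrum of `L`,
the right end for the negative one. -/
def startTime (ε : ℝ) (k : ℤ) : ℝ := if k ≤ 0 then 0 else ε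

theorem startTime_mem (hε : 0 ≤ ε) (k : ℤ) : startTime ε k ∈ Set.Icc 0 ε := by
  unfold startTime
  split_ifs
  · exact ⟨le_rfl, hε⟩
  · exact ⟨hε, le_rfl⟩

theorem exp_eq_expKernel {k : ℤ} {t s : ℝ} (h : (k ≤ 0 ∧ s ≤ t) ∨ (0 ≤ k ∧ t ≤ s)) :
    Real.exp (k * (t - s)) = expKernel |(k : ℝ)| t s := by
  unfold expKernel
  rcases h with ⟨h1, h2⟩ | ⟨h1, h2⟩
  · have : (k : ℝ) ≤ 0 := by exact_mod_cast h1
    rw [abs_of_nonpos this, abs_of_nonneg (sub_nonneg.2 h2)]; ring_nf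
  · have : (0 : ℝ) ≤ k := by exact_mod_cast h1
    rw [abs_of_nonneg this, abs_of_nonpos (sub_nonpos.2 h2)]; ring_nf

/-- Integration starts at the end from which $e^{k(t-s)}$ decays, so on the whole interval of
integration it equals $e^{-|k||t-s|}$. The integral may then be enlarged to all of $(0,\epsilon)$,
because the integrand is nonnegative. -/
theorem norm_modeSol_le (k : ℤ) (y : Cn n)
    {F : ℝ → Cn n} (hF : Integrable F (timeMeasure ε)) {t : ℝ} (ht : t ∈ Set.Icc 0 ε) :
    ‖modeSol k (startTime ε k) y F t‖ ≤ expKernel |(k : ℝ)| t (startTime ε k) * ‖y‖ +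
      ∫ s, expKernel |(k : ℝ)| t s * ‖F s‖ ∂(timeMeasure ε) := by
  have hi : Integrable (fun s => expKernel |(k : ℝ)| t s * ‖F s‖) (timeMeasure ε) :=
    integrable_expKernel_mul _ t hF.norm
  have hpos : 0 ≤ᵐ[timeMeasure ε] fun s => expKernel |(k : ℝ)| t s * ‖F s‖ :=
    Eventually.of_forall fun s => mul_nonneg (expKernel_pos _ _ _).le (norm_nonneg _)
  have key : ∀ a b : ℝ, 0 ≤ a → b ≤ ε → a ≤ b →
      (∀ s ∈ Set.Ioo a b, Real.exp (k * (t - s)) = expKernel |(k : ℝ)| t s) →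
      ‖∫ s in a..b, Real.exp (k * (t - s)) • F s‖ ≤
        ∫ s, expKernel |(k : ℝ)| t s * ‖F s‖ ∂(timeMeasure ε) := by
    intro a b ha hb hab hker
    rw [intervalIntegral.integral_of_le hab, integral_Ioc_eq_integral_Ioo]
    refine (norm_integral_le_integral_norm _).trans ?_
    have h1 : ∫ s in Set.Ioo a b, ‖Real.exp (k * (t - s)) • F s‖ =
        ∫ s in Set.Ioo a b, expKernel |(k : ℝ)| t s * ‖F s‖ := by
      refine setIntegral_congr_fun measurableSet_Ioo fun s hs => ?_
      rw [norm_smul, Real.norm_of_nonneg (Real.exp_pos _).le, hker s hs]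
    rw [h1]
    exact setIntegral_mono_set hi hpos
      (LE.le.eventuallyLE (Set.Ioo_subset_Ioo ha hb))
  rw [modeSol]
  refine (norm_add_le _ _).trans (add_le_add ?_ ?_)
  · rw [norm_smul, Real.norm_of_nonneg (Real.exp_pos _).le]
    refine mul_le_mul_of_nonneg_right (exp_eq_expKernel ?_).le (norm_nonneg _)
    unfold startTime
    split_ifs with h
    · exact Or.inl ⟨h, ht.1⟩
    · exact Or.inr ⟨(not_le.1 h).le, ht.2⟩
  · unfold startTime
    split_ifs with h
    · exact key 0 t le_rfl ht.2 ht.1 fun s hs => exp_eq_expKernel (Or.inl ⟨h, hs.2.le⟩)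
    · rw [intervalIntegral.integral_symm, norm_neg]
      exact key t ε ht.1 le_rfl ht.2 fun s hs =>
        exp_eq_expKernel (Or.inr ⟨(not_le.1 h).le, hs.1.le⟩)

theorem sq_norm_modeSol_le (hε : 0 < ε) (k : ℤ) (y : Cn n)
    {F : ℝ → Cn n} (hF : MemLp F 2 (timeMeasure ε)) {t : ℝ} (ht : t ∈ Set.Icc 0 ε) :
    ‖modeSol k (startTime ε k) y F t‖ ^ 2 ≤
      2 * ‖y‖ ^ 2 + 2 * ε * ∫ s, ‖F s‖ ^ 2 ∂(timeMeasure ε) := by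
  have h1 := norm_modeSol_le k y (hF.integrable (by norm_num)) ht
  have h2 := sq_integral_expKernel_mul_le hε
    (integral_expKernel_le_length hε.le (abs_nonneg (k : ℝ)) t) hF.norm
  have h3 : expKernel |(k : ℝ)| t (startTime ε k) * ‖y‖ ≤ ‖y‖ :=
    mul_le_of_le_one_left (norm_nonneg _) (expKernel_le_one (abs_nonneg _) _ _)
  have h4 : ∫ s, expKernel |(k : ℝ)| t s * ‖F s‖ ^ 2 ∂(timeMeasure ε) ≤
      ∫ s, ‖F s‖ ^ 2 ∂(timeMeasure ε) :=
    integral_mono (integrable_expKernel_mul _ t hF.norm.integrable_sq) hF.norm.integrable_sq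
      fun s => mul_le_of_le_one_left (sq_nonneg _) (expKernel_le_one (abs_nonneg _) _ _)
  have h5 := mul_le_mul_of_nonneg_left h4 hε.le
  set m := ∫ s, expKernel |(k : ℝ)| t s * ‖F s‖ ∂(timeMeasure ε)
  have h6 : ‖modeSol k (startTime ε k) y F t‖ ^ 2 ≤ (‖y‖ + m) ^ 2 :=
    pow_le_pow_left₀ (norm_nonneg _) (h1.trans (by gcongr)) 2
  have h7 := add_sq_le (a := ‖y‖) (b := m)
  linarith

theorem integral_sq_norm_modeSol_le (k : ℤ) (y : Cn n)
    {F : ℝ → Cn n} (hF : MemLp F 2 (timeMeasure ε)) {A : ℝ} (hA : 0 < A)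
    (hK : ∀ t, ∫ s, expKernel |(k : ℝ)| t s ∂(timeMeasure ε) ≤ A) :
    ∫ t, ‖modeSol k (startTime ε k) y F t‖ ^ 2 ∂(timeMeasure ε) ≤
      2 * A * ‖y‖ ^ 2 + 2 * A ^ 2 * ∫ s, ‖F s‖ ^ 2 ∂(timeMeasure ε) := by
  have hF1 := hF.integrable (by norm_num : (1 : ENNReal) ≤ 2)
  set τ := startTime ε k
  set κ := |(k : ℝ)|
  have hS := integral_sq_integral_expKernel_mul_le hA hK hF.norm
  set g : ℝ → ℝ := fun t => ∫ s, expKernel κ t s * ‖F s‖ ∂(timeMeasure ε) with hg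
  have hgi : Integrable (fun t => g t ^ 2) (timeMeasure ε) := by
    have hp := (integrable_expKernel_mul_prod κ hF.norm.integrable_sq).integral_prod_left.const_mul A
    refine hp.mono' ((integrable_expKernel_mul_prod κ
      hF1.norm).integral_prod_left.aestronglyMeasurable.pow 2) (Eventually.of_forall fun t => ?_)
    rw [Real.norm_of_nonneg (sq_nonneg _)]
    exact sq_integral_expKernel_mul_le hA (hK t) hF.norm
  have hki : Integrable (fun t => expKernel κ t τ) (timeMeasure ε) := by
    simp only [expKernel_symm κ _ τ]; exact integrable_expKernel κ τ
  have hKτ : ∫ t, expKernel κ t τ ∂(timeMeasure ε) ≤ A := by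
    simp only [expKernel_symm κ _ τ]; exact hK τ
  have hle : ∫ t, ‖modeSol k τ y F t‖ ^ 2 ∂(timeMeasure ε) ≤
      ∫ t, (2 * ‖y‖ ^ 2 * expKernel κ t τ + 2 * g t ^ 2) ∂(timeMeasure ε) := by
    refine integral_mono_of_nonneg (Eventually.of_forall fun t => sq_nonneg _)
      ((hki.const_mul _).add (hgi.const_mul _)) ?_
    filter_upwards [ae_mem_timeMeasure ε] with t ht
    have h1 : ‖modeSol k τ y F t‖ ≤ expKernel κ t τ * ‖y‖ + g t :=
      norm_modeSol_le k y hF1 (Set.Ioo_subset_Icc_self ht)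
    have h2 : ‖modeSol k τ y F t‖ ^ 2 ≤ (expKernel κ t τ * ‖y‖ + g t) ^ 2 :=
      pow_le_pow_left₀ (norm_nonneg _) h1 2
    have h3 := add_sq_le (a := expKernel κ t τ * ‖y‖) (b := g t)
    -- Since the kernel is at most $1$, its square integral is also at most $A$; this gives the
    -- boundary term a single factor $A$, while the Schur test gives the source term two.
    have h4 : expKernel κ t τ ^ 2 ≤ expKernel κ t τ :=
      pow_le_of_le_one (expKernel_pos _ _ _).le (expKernel_le_one (abs_nonneg _) _ _) two_ne_zero
    have h5 := mul_le_mul_of_nonneg_left h4 (sq_nonneg ‖y‖)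
    rw [mul_pow] at h3
    nlinarith
  refine hle.trans ?_
  rw [integral_add (hki.const_mul _) (hgi.const_mul _), integral_const_mul, integral_const_mul]
  have h6 := mul_le_mul_of_nonneg_left hKτ (sq_nonneg ‖y‖)
  linarith

/-! ### Existence for the linear equation -/

theorem hasSum_integral_smul {α ι : Type*} [MeasurableSpace α] {μ : Measure α} {φ : α → ℝ}
    (hφ : MemLp φ 2 μ) {x : ι → Lp (Cn n) 2 μ} {X : Lp (Cn n) 2 μ} (h : HasSum x X) :
    HasSum (fun i => ∫ p, φ p • x i p ∂μ) (∫ p, φ p • X p ∂μ) := by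
  have hB := ((ContinuousLinearMap.lsmul ℝ ℝ (E := Cn n)).lpPairing μ 2 2 (hφ.toLp φ)).hasSum h
  have key : ∀ z : Lp (Cn n) 2 μ,
      (ContinuousLinearMap.lsmul ℝ ℝ (E := Cn n)).lpPairing μ 2 2 (hφ.toLp φ) z =
        ∫ p, φ p • z p ∂μ := fun z => by
    rw [ContinuousLinearMap.lpPairing_eq_integral]
    refine integral_congr_ae ?_
    filter_upwards [hφ.coeFn_toLp] with p hp
    rw [hp]; rfl
  simpa only [key] using hB

namespace IsSmoothOnCyl

variable {φ : ℝ × ℝ → ℝ}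

theorem continuous (hφ : IsSmoothOnCyl φ) : Continuous φ := hφ.smooth.continuous

theorem differentiableAt (hφ : IsSmoothOnCyl φ) (p : ℝ × ℝ) : DifferentiableAt ℝ φ p :=
  (hφ.smooth.differentiable (by norm_num)).differentiableAt

theorem continuous_fderiv_apply (hφ : IsSmoothOnCyl φ) (e : ℝ × ℝ) : Continuous fun p => fderiv ℝ φ p e :=
  (hφ.smooth.continuous_fderiv (by norm_num)).clm_apply continuous_const

theorem hasDerivAt_fst (hφ : IsSmoothOnCyl φ) (t θ : ℝ) :
    HasDerivAt (fun t => φ (t, θ)) (fderiv ℝ φ (t, θ) (1, 0)) t :=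
  (hφ.differentiableAt (t, θ)).hasFDerivAt.comp_hasDerivAt t
    ((hasDerivAt_id t).prodMk (hasDerivAt_const t θ))

theorem hasDerivAt_snd (hφ : IsSmoothOnCyl φ) (t θ : ℝ) :
    HasDerivAt (fun θ => φ (t, θ)) (fderiv ℝ φ (t, θ) (0, 1)) θ :=
  (hφ.differentiableAt (t, θ)).hasFDerivAt.comp_hasDerivAt θ
    ((hasDerivAt_const θ t).prodMk (hasDerivAt_id θ))

theorem integral_deriv_mul_circleExp (hφ : IsSmoothOnCyl φ) (k : ℤ) (t : ℝ) :
    ∫ θ, ((fderiv ℝ φ (t, θ) (0, 1) : ℂ) * circleExp k θ +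
      φ (t, θ) * (k * Complex.I * circleExp k θ)) ∂circleMeasure = 0 := by
  rw [integral_circleMeasure]
  have hd : ∀ θ ∈ Set.uIcc 0 (2 * Real.pi), HasDerivAt (fun θ => (φ (t, θ) : ℂ) * circleExp k θ)
      ((fderiv ℝ φ (t, θ) (0, 1) : ℂ) * circleExp k θ +
        φ (t, θ) * (k * Complex.I * circleExp k θ)) θ := fun θ _ =>
    (hφ.hasDerivAt_snd t θ).ofReal_comp.mul (hasDerivAt_circleExp k θ)
  rw [intervalIntegral.integral_eq_sub_of_hasDerivAt hd]
  · have h1 := hφ.periodic t 0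
    have h2 := circleExp_add_two_pi k 0
    rw [zero_add] at h1 h2
    rw [h1, h2, sub_self]
  · have c1 : Continuous fun θ => fderiv ℝ φ (t, θ) (0, 1) :=
      (hφ.continuous_fderiv_apply (0, 1)).comp (Continuous.prodMk_right t)
    have c2 : Continuous fun θ => φ (t, θ) := hφ.continuous.comp (Continuous.prodMk_right t)
    have c3 := continuous_circleExp k
    exact Continuous.intervalIntegrable (((Complex.continuous_ofReal.comp c1).mul c3).add
      ((Complex.continuous_ofReal.comp c2).mul (continuous_const.mul c3))) _ _

end IsSmoothOnCyl

/-- Fubini with $\theta$ as inner variable; there the integrand is a total derivative of a periodic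
function. -/
theorem integral_deriv_snd_smul_modeEmb {φ : ℝ × ℝ → ℝ} (hφ : IsSmoothOnCyl φ) (k : ℤ)
    (g : Lp (Cn n) 2 (timeMeasure ε)) :
    ∫ p, fderiv ℝ φ p (0, 1) • modeEmb n ε k g p ∂(cylMeasure ε) =
      -∫ p, φ p • modeEmb n ε k ((k * Complex.I : ℂ) • g) p ∂(cylMeasure ε) := by
  have i1 := integrable_continuous_smul (hφ.continuous_fderiv_apply (0, 1))
    ((Lp.memLp (modeEmb n ε k g)).integrable (by norm_num))
  have i2 := integrable_continuous_smul hφ.continuous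
    ((Lp.memLp (modeEmb n ε k ((k * Complex.I : ℂ) • g))).integrable (by norm_num))
  rw [← add_eq_zero_iff_eq_neg, ← integral_add i1 i2]
  have h := i1.add i2
  have hae : (fun p => fderiv ℝ φ p (0, 1) • modeEmb n ε k g p +
      φ p • modeEmb n ε k ((k * Complex.I : ℂ) • g) p) =ᵐ[cylMeasure ε] fun p =>
      ((fderiv ℝ φ p (0, 1) : ℂ) * circleExp k p.2 + φ p * (k * Complex.I * circleExp k p.2)) •
        g p.1 := by
    filter_upwards [coeFn_modeEmb k g, coeFn_modeEmb k ((k * Complex.I : ℂ) • g),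
      ae_cylMeasure_of_ae_timeMeasure (Lp.coeFn_smul (k * Complex.I : ℂ) g)] with p h1 h2 h3
    rw [h1, h2, h3]
    simp only [Pi.smul_apply, ← Complex.coe_smul, smul_smul, ← add_smul]
    congr 1; ring
  rw [integral_congr_ae hae]
  have h' := h.congr hae
  rw [cylMeasure_eq_prod] at h' ⊢
  rw [integral_prod _ h']
  refine integral_eq_zero_of_ae (Eventually.of_forall fun t => ?_)
  simp only [integral_smul_const, hφ.integral_deriv_mul_circleExp k t, zero_smul, Pi.zero_apply]

/-- Fubini with $t$ as inner variable; for each fixed $\theta$ this is the weak form of the mode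
equation tested against $\varphi(\cdot,\theta)$. -/
theorem green_modeEmb (hε : 0 < ε) {φ : ℝ × ℝ → ℝ} (hφ : IsSmoothOnCyl φ) (k : ℤ) {τ : ℝ}
    (hτ : τ ∈ Set.Icc 0 ε) (y : Cn n) (F S : Lp (Cn n) 2 (timeMeasure ε))
    (hS : S =ᵐ[timeMeasure ε] modeSol k τ y F) :
    ∫ p, fderiv ℝ φ p (1, 0) • modeEmb n ε k S p ∂(cylMeasure ε) +
      ∫ p, φ p • modeEmb n ε k (F + (k : ℂ) • S) p ∂(cylMeasure ε) =
    ∫ θ, φ (ε, θ) • loopEmb n k (modeSol k τ y F ε) θ ∂circleMeasure -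
      ∫ θ, φ (0, θ) • loopEmb n k (modeSol k τ y F 0) θ ∂circleMeasure := by
  have hF : Integrable F (timeMeasure ε) := (Lp.memLp F).integrable (by norm_num)
  have i1 := integrable_continuous_smul (hφ.continuous_fderiv_apply (1, 0))
    ((Lp.memLp (modeEmb n ε k S)).integrable (by norm_num))
  have i2 := integrable_continuous_smul hφ.continuous
    ((Lp.memLp (modeEmb n ε k (F + (k : ℂ) • S))).integrable (by norm_num))
  have hslice : ∀ t : ℝ, Continuous fun θ => φ (t, θ) := fun t =>
    hφ.continuous.comp (Continuous.prodMk_right t)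
  have ib : ∀ (t : ℝ) (v : Cn n),
      Integrable (fun θ => φ (t, θ) • loopEmb n k v θ) circleMeasure := fun t v =>
    integrable_continuous_smul_time (ε := 2 * Real.pi) (hslice t)
      ((Lp.memLp (loopEmb n k v)).integrable (by norm_num))
  rw [← integral_add i1 i2, ← integral_sub (ib _ _) (ib _ _)]
  have hae : (fun p => fderiv ℝ φ p (1, 0) • modeEmb n ε k S p +
      φ p • modeEmb n ε k (F + (k : ℂ) • S) p) =ᵐ[cylMeasure ε] fun p =>
      circleExp k p.2 • (fderiv ℝ φ p (1, 0) • modeSol k τ y F p.1 +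
        φ p • ((k : ℝ) • modeSol k τ y F p.1 + F p.1)) := by
    filter_upwards [coeFn_modeEmb k S, coeFn_modeEmb k (F + (k : ℂ) • S),
      ae_cylMeasure_of_ae_timeMeasure (Lp.coeFn_smul (k : ℂ) S),
      ae_cylMeasure_of_ae_timeMeasure (Lp.coeFn_add F ((k : ℂ) • S)),
      ae_cylMeasure_of_ae_timeMeasure hS] with p h1 h2 h3 h4 h5
    rw [h1, h2, h4, Pi.add_apply, h3, Pi.smul_apply, h5]
    simp only [← Complex.coe_smul, smul_add, smul_smul, Complex.ofReal_intCast]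
    rw [add_comm (_ • F p.1)]
    congr 2 <;> ring_nf
  rw [integral_congr_ae hae]
  have h' := (i1.add i2).congr hae
  rw [cylMeasure_eq_prod] at h' ⊢
  rw [integral_prod_symm _ h']
  refine integral_congr_ae ?_
  filter_upwards [coeFn_loopEmb k (modeSol k τ y F ε), coeFn_loopEmb k (modeSol k τ y F 0)]
    with θ h1 h2
  have hφθ : ContDiff ℝ 1 fun t => φ (t, θ) :=
    (hφ.smooth.of_le (by norm_num)).comp (contDiff_id.prodMk contDiff_const)
  have hg := integral_deriv_smul_modeSol hε k hτ y hF hφθ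
  simp only [(hφ.hasDerivAt_fst _ θ).deriv] at hg
  rw [h1, h2]
  simp only [integral_smul, hg, smul_sub, smul_comm (circleExp k θ)]

/-- The weight of the `k`-th mode in the estimate of `∂_θ u` by the boundary value. -/
def modeWeight (ε : ℝ) (k : ℤ) : ℝ := min ((k : ℝ) ^ 2 * ε) (2 * |(k : ℝ)|)

theorem modeWeight_nonneg (hε : 0 ≤ ε) (k : ℤ) : 0 ≤ modeWeight ε k :=
  le_min (by positivity) (by positivity)

theorem modeWeight_le (ε : ℝ) (k : ℤ) : modeWeight ε k ≤ 2 * |(k : ℝ)| := min_le_right _ _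

theorem norm_sq_modeSol_toLp_le (hε : 0 < ε) (k : ℤ) (y : Cn n) (f : Lp (Cn n) 2 (timeMeasure ε))
    (hs : MemLp (modeSol k (startTime ε k) y f) 2 (timeMeasure ε)) :
    ‖hs.toLp _‖ ^ 2 ≤ 2 * ε * ‖y‖ ^ 2 + 2 * ε ^ 2 * ‖f‖ ^ 2 := by
  rw [norm_sq_toLp_eq_integral, norm_sq_eq_integral f]
  exact integral_sq_norm_modeSol_le k y (Lp.memLp f) hε
    (integral_expKernel_le_length hε.le (abs_nonneg _))

theorem norm_sq_smul_modeSol_toLp_le (hε : 0 < ε) (k : ℤ) (y : Cn n)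
    (f : Lp (Cn n) 2 (timeMeasure ε))
    (hs : MemLp (modeSol k (startTime ε k) y f) 2 (timeMeasure ε)) :
    ‖(k * Complex.I : ℂ) • hs.toLp _‖ ^ 2 ≤
      2 * (modeWeight ε k * ‖y‖ ^ 2) + 8 * ‖f‖ ^ 2 := by
  have hn : ‖(k * Complex.I : ℂ)‖ = |(k : ℝ)| := by simp
  rw [norm_smul, mul_pow, hn]
  by_cases hk : k = 0
  · subst hk
    have := modeWeight_nonneg hε.le 0
    simp only [Int.cast_zero, abs_zero, ne_eq, OfNat.ofNat_ne_zero, not_false_eq_true, zero_pow,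
      zero_mul]
    positivity
  have hk0 : 0 < |(k : ℝ)| := abs_pos.2 (by exact_mod_cast hk)
  rw [norm_sq_toLp_eq_integral, norm_sq_eq_integral f]
  set m := ∫ t, ‖f t‖ ^ 2 ∂(timeMeasure ε)
  have hm : 0 ≤ m := integral_nonneg fun t => sq_nonneg _
  set κ := |(k : ℝ)| with hκ
  -- Both bounds on the mass of the kernel are needed: $\kappa^2A$ is exactly `modeWeight ε k`, and
  -- $\kappa A\le 2$ makes the source term cost $2\cdot 2^2=8$ uniformly in $k$.
  set A := min ε (2 / κ) with hA
  have hA0 : 0 < A := lt_min hε (by positivity)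
  have h := integral_sq_norm_modeSol_le k y (Lp.memLp f) hA0 fun t =>
    le_min (integral_expKernel_le_length hε.le hk0.le t) (integral_expKernel_le_inv hk0 t)
  have e1 : κ ^ 2 * A = modeWeight ε k := by
    rw [hA, mul_min_of_nonneg _ _ (sq_nonneg κ), modeWeight, hκ, sq_abs]
    congr 1
    rw [← sq_abs, ← hκ]; field_simp
  have e2 : κ * A ≤ 2 := by
    have := mul_le_mul_of_nonneg_left (min_le_right ε (2 / κ)) hk0.le
    rwa [mul_div_cancel₀ _ hk0.ne'] at this
  have e3 : (κ * A) ^ 2 ≤ 4 := by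
    have := pow_le_pow_left₀ (by positivity) e2 2
    linarith
  calc κ ^ 2 * ∫ t, ‖modeSol k (startTime ε k) y f t‖ ^ 2 ∂(timeMeasure ε)
      ≤ κ ^ 2 * (2 * A * ‖y‖ ^ 2 + 2 * A ^ 2 * m) := mul_le_mul_of_nonneg_left h (sq_nonneg _)
    _ = 2 * (modeWeight ε k * ‖y‖ ^ 2) + 2 * ((κ * A) ^ 2 * m) := by rw [← e1]; ring
    _ ≤ _ := by nlinarith

/-- The modes are solved separately and summed. The one-mode bounds make $u$, $\partial_\theta u$
and both traces converge in $L^2$; $\partial_tu$ is then defined by the equation as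
$F-J\partial_\theta u$. Green's formula and the weak derivative identity hold mode by mode and pass
to the sum, as both sides are continuous in $L^2$. -/
theorem exists_linear_solution (hε : 0 < ε) (F : Lp (Cn n) 2 (cylMeasure ε)) (y : ℤ → Cn n)
    (hy : Summable fun k => ‖y k‖ ^ 2) (hy' : Summable fun k : ℤ => |(k : ℝ)| * ‖y k‖ ^ 2) :
    ∃ γ : LOne n ε, (∀ᵐ p ∂(cylMeasure ε), γ.ut p + Complex.I • γ.uθ p = F p) ∧
      (∃ f₀ f₁ : ℝ → Cn n, γ.HasTraces f₀ f₁ ∧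
        (∀ k ≤ 0, ∫ θ, circleExp (-k) θ • f₀ θ ∂circleMeasure = y k) ∧
        ∀ k > 0, ∫ θ, circleExp (-k) θ • f₁ θ ∂circleMeasure = y k) ∧
      ‖γ.u‖ ^ 2 ≤ 2 * ε * ∑' k, ‖y k‖ ^ 2 + 2 * ε ^ 2 * ‖F‖ ^ 2 ∧
      ‖γ.uθ‖ ^ 2 ≤ 2 * ∑' k, modeWeight ε k * ‖y k‖ ^ 2 + 8 * ‖F‖ ^ 2 := by
  obtain ⟨f, hfF, hfn⟩ := exists_hasSum_modeEmb F
  have hfi : ∀ k, Integrable (f k) (timeMeasure ε) := fun k =>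
    (Lp.memLp (f k)).integrable (by norm_num)
  set s : ℤ → ℝ → Cn n := fun k => modeSol k (startTime ε k) (y k) (f k) with hs
  have hsm : ∀ k, MemLp (s k) 2 (timeMeasure ε) := fun k => memLp_of_continuousOn_Icc
    (continuousOn_modeSol hε.le k (startTime_mem hε.le k) (y k) (hfi k))
  set S : ℤ → Lp (Cn n) 2 (timeMeasure ε) := fun k => (hsm k).toLp _ with hS
  have hwy : Summable fun k => modeWeight ε k * ‖y k‖ ^ 2 :=
    Summable.of_nonneg_of_le (fun k => mul_nonneg (modeWeight_nonneg hε.le k) (sq_nonneg _))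
      (fun k => by
        have := mul_le_mul_of_nonneg_right (modeWeight_le ε k) (sq_nonneg ‖y k‖)
        rwa [mul_assoc] at this) (hy'.mul_left 2)
  have b1 : ∀ k, ‖S k‖ ^ 2 ≤ 2 * ε * ‖y k‖ ^ 2 + 2 * ε ^ 2 * ‖f k‖ ^ 2 := fun k =>
    norm_sq_modeSol_toLp_le hε k (y k) (f k) (hsm k)
  have b2 : ∀ k : ℤ, ‖(k * Complex.I : ℂ) • S k‖ ^ 2 ≤
      2 * (modeWeight ε k * ‖y k‖ ^ 2) + 8 * ‖f k‖ ^ 2 := fun k =>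
    norm_sq_smul_modeSol_toLp_le hε k (y k) (f k) (hsm k)
  have sum1 := (hy.mul_left (2 * ε)).add (hfn.summable.mul_left (2 * ε ^ 2))
  have sum2 := (hwy.mul_left 2).add (hfn.summable.mul_left 8)
  have sS : Summable fun k => ‖S k‖ ^ 2 :=
    Summable.of_nonneg_of_le (fun k => sq_nonneg _) b1 sum1
  have sT : Summable fun k : ℤ => ‖(k * Complex.I : ℂ) • S k‖ ^ 2 :=
    Summable.of_nonneg_of_le (fun k => sq_nonneg _) b2 sum2
  obtain ⟨U, hU, hUn⟩ := hasSum_of_summable_sq (orthogonalFamily_modeEmb n ε) sS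
  obtain ⟨T, hT, hTn⟩ := hasSum_of_summable_sq (orthogonalFamily_modeEmb n ε) sT
  have htr : ∀ t ∈ Set.Icc 0 ε, Summable fun k => ‖s k t‖ ^ 2 := fun t ht =>
    Summable.of_nonneg_of_le (fun k => sq_nonneg _) (fun k => by
      have := sq_norm_modeSol_le hε k (y k) (Lp.memLp (f k)) ht
      rwa [← norm_sq_eq_integral (f k)] at this)
      ((hy.mul_left 2).add (hfn.summable.mul_left (2 * ε)))
  obtain ⟨f₀, hf₀, -⟩ := hasSum_of_summable_sq (orthogonalFamily_loopEmb n)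
    (htr 0 ⟨le_rfl, hε.le⟩)
  obtain ⟨f₁, hf₁, -⟩ := hasSum_of_summable_sq (orthogonalFamily_loopEmb n)
    (htr ε ⟨hε.le, le_rfl⟩)
  set W : Lp (Cn n) 2 (cylMeasure ε) := F - Complex.I • T with hW
  -- Since $i\cdot ik=-k$, the $k$-th mode of $F-J\partial_\theta u$ is $f_k+ks_k$, the derivative
  -- that the mode equation prescribes.
  have hWs : HasSum (fun k => modeEmb n ε k (f k + (k : ℂ) • S k)) W := by
    have := hfF.sub (hT.const_smul Complex.I)
    convert! this using 2 with k
    rw [← map_smul, ← map_sub, smul_smul, sub_eq_add_neg, ← neg_smul]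
    congr 3
    linear_combination (k : ℂ) * Complex.I_mul_I
  have iX : ∀ (φ : ℝ × ℝ → ℝ), Continuous φ → ∀ g : Lp (Cn n) 2 (cylMeasure ε),
      Integrable (fun p => φ p • g p) (cylMeasure ε) := fun φ hφ g =>
    integrable_continuous_smul hφ ((Lp.memLp g).integrable (by norm_num))
  have hgreen : ∀ φ : ℝ × ℝ → ℝ, IsSmoothOnCyl φ →
      ∫ p, (fderiv ℝ φ p (1, 0)) • U p ∂(cylMeasure ε) + ∫ p, φ p • W p ∂(cylMeasure ε) =
        ∫ θ, φ (ε, θ) • f₁ θ ∂circleMeasure - ∫ θ, φ (0, θ) • f₀ θ ∂circleMeasure := by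
    intro φ hφ
    have hslice : ∀ t : ℝ, MemLp (fun θ => φ (t, θ)) 2 circleMeasure := fun t =>
      memLp_circleMeasure_of_continuous (hφ.continuous.comp (Continuous.prodMk_right t)) 2
    have hL := (hasSum_integral_smul (memLp_cylMeasure_of_continuous
      (hφ.continuous_fderiv_apply (1, 0)) ε 2) hU).add
      (hasSum_integral_smul (memLp_cylMeasure_of_continuous hφ.continuous ε 2) hWs)
    have hR := (hasSum_integral_smul (hslice ε) hf₁).sub (hasSum_integral_smul (hslice 0) hf₀)
    refine hL.unique ?_
    convert! hR using 2 with k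
    exact green_modeEmb hε hφ k (startTime_mem hε.le k) (y k) (f k) (S k) (hsm k).coeFn_toLp
  have hθ : ∀ φ : ℝ × ℝ → ℝ, IsSmoothOnCyl φ →
      ∫ p, (fderiv ℝ φ p (0, 1)) • U p ∂(cylMeasure ε) = -∫ p, φ p • T p ∂(cylMeasure ε) := by
    intro φ hφ
    have hL := hasSum_integral_smul (memLp_cylMeasure_of_continuous
      (hφ.continuous_fderiv_apply (0, 1)) ε 2) hU
    have hR := (hasSum_integral_smul (memLp_cylMeasure_of_continuous hφ.continuous ε 2) hT).neg
    refine hL.unique ?_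
    convert! hR using 2 with k
    exact integral_deriv_snd_smul_modeEmb hφ k (S k)
  refine ⟨⟨U, W, T, ?_, ?_⟩, ?_, ⟨f₀, f₁, ⟨Lp.memLp f₀, Lp.memLp f₁, ?_⟩, ?_, ?_⟩, ?_, ?_⟩
  · rintro φ hφ ⟨δ, hδ, h0⟩
    have h := hgreen φ hφ
    have z1 : ∀ θ, φ (ε, θ) = 0 := fun θ => h0 ε θ (Or.inr (by linarith))
    have z0 : ∀ θ, φ (0, θ) = 0 := fun θ => h0 0 θ (Or.inl hδ.le)
    simp only [z1, z0, zero_smul, integral_zero, sub_zero] at h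
    exact eq_neg_of_add_eq_zero_left h
  · rintro φ hφ -
    exact hθ φ hφ
  · filter_upwards [Lp.coeFn_sub F (Complex.I • T), Lp.coeFn_smul Complex.I T] with p h1 h2
    rw [hW, h1, Pi.sub_apply, h2, Pi.smul_apply, sub_add_cancel]
  · intro φ hφ
    rw [integral_add (iX _ (hφ.continuous_fderiv_apply (1, 0)) U) (iX _ hφ.continuous W),
      hgreen φ hφ, integral_sub]
    · exact integrable_continuous_smul_time (ε := 2 * Real.pi)
        (hφ.continuous.comp (Continuous.prodMk_right ε)) ((Lp.memLp f₁).integrable (by norm_num))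
    · exact integrable_continuous_smul_time (ε := 2 * Real.pi)
        (hφ.continuous.comp (Continuous.prodMk_right 0)) ((Lp.memLp f₀).integrable (by norm_num))
  · intro k hk
    rw [integral_circleExp_smul_of_hasSum hf₀ k]
    have : startTime ε k = 0 := if_pos hk
    simp only [hs, this, modeSol_self]
  · intro k hk
    rw [integral_circleExp_smul_of_hasSum hf₁ k]
    have : startTime ε k = ε := if_neg (not_le.2 hk)
    simp only [hs, this, modeSol_self]
  · change ‖U‖ ^ 2 ≤ _
    rw [hUn, ← hfn.tsum_eq, ← tsum_mul_left, ← tsum_mul_left,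
      ← (hy.mul_left (2 * ε)).tsum_add (hfn.summable.mul_left (2 * ε ^ 2))]
    exact sS.tsum_le_tsum b1 sum1
  · change ‖T‖ ^ 2 ≤ _
    rw [hTn, ← hfn.tsum_eq, ← tsum_mul_left, ← tsum_mul_left,
      ← (hwy.mul_left 2).tsum_add (hfn.summable.mul_left 8)]
    exact sT.tsum_le_tsum b2 sum2

/-! ### Uniqueness for the linear equation -/

/-- The test function `χ(t) Re (c e_k(θ))`. -/
def reTest (χ : ℝ → ℝ) (c : ℂ) (k : ℤ) (p : ℝ × ℝ) : ℝ := χ p.1 * (c * circleExp k p.2).re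

theorem hasFDerivAt_reTest {χ : ℝ → ℝ} (hχ : ContDiff ℝ ((⊤ : ℕ∞) : WithTop ℕ∞) χ) (c : ℂ) (k : ℤ)
    (p : ℝ × ℝ) : HasFDerivAt (reTest χ c k)
      (χ p.1 • ((c * (k * Complex.I * circleExp k p.2)).re • ContinuousLinearMap.snd ℝ ℝ ℝ) +
        (c * circleExp k p.2).re • (deriv χ p.1 • ContinuousLinearMap.fst ℝ ℝ ℝ)) p := by
  have h1 : HasFDerivAt (fun p : ℝ × ℝ => χ p.1) (deriv χ p.1 • ContinuousLinearMap.fst ℝ ℝ ℝ) p :=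
    ((hχ.differentiable (by norm_num)).differentiableAt).hasDerivAt.comp_hasFDerivAt p
      hasFDerivAt_fst
  have h2 : HasDerivAt (fun θ => (c * circleExp k θ).re)
      (c * (k * Complex.I * circleExp k p.2)).re p.2 :=
    Complex.reCLM.hasFDerivAt.comp_hasDerivAt p.2 ((hasDerivAt_circleExp k p.2).const_mul c)
  have h3 : HasFDerivAt (fun p : ℝ × ℝ => (c * circleExp k p.2).re)
      ((c * (k * Complex.I * circleExp k p.2)).re • ContinuousLinearMap.snd ℝ ℝ ℝ) p :=
    HasDerivAt.comp_hasFDerivAt (h₂ := fun θ => (c * circleExp k θ).re) p h2 hasFDerivAt_snd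
  exact h1.mul h3

theorem isSmoothOnCyl_reTest {χ : ℝ → ℝ} (hχ : ContDiff ℝ ((⊤ : ℕ∞) : WithTop ℕ∞) χ) (c : ℂ)
    (k : ℤ) : IsSmoothOnCyl (reTest χ c k) := by
  refine ⟨?_, fun t θ => ?_⟩
  · exact (hχ.comp contDiff_fst).mul (Complex.reCLM.contDiff.comp
      (contDiff_const.mul ((contDiff_circleExp k).comp contDiff_snd)))
  · simp only [reTest, circleExp_add_two_pi]

/-- The test functions in `LOne` are real. Splitting into real and imaginary parts lets identities
for the real functions $\chi\,\mathrm{Re}(c\,e_k)$, with $c$ and $-ic$, yield the complex Fourier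
modes. -/
theorem integral_complex_smul {α : Type*} [MeasurableSpace α] {μ : Measure α} (z : α → ℂ)
    (w : α → Cn n)
    (hre : Integrable (fun p => (z p).re • w p) μ) (him : Integrable (fun p => (z p).im • w p) μ) :
    ∫ p, z p • w p ∂μ = ∫ p, (z p).re • w p ∂μ + Complex.I • ∫ p, (z p).im • w p ∂μ := by
  have him' : Integrable (fun p => Complex.I • (z p).im • w p) μ := him.smul Complex.I
  rw [← integral_smul, ← integral_add hre him']
  refine integral_congr_ae (Eventually.of_forall fun p => ?_)
  simp only [← Complex.coe_smul, smul_smul, ← add_smul]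
  congr 1
  linear_combination -(Complex.re_add_im (z p))

theorem im_eq_re_neg_I_mul (z : ℂ) : z.im = (-Complex.I * z).re := by simp

/-- A linear relation between integrals against all test functions `χ(t) Re (c e_k(θ))` yields
one for `χ(t) e_k(θ)`. -/
theorem integral_smul_circleExp_eq_re_add_im {w : ℝ × ℝ → Cn n} (hw : Integrable w (cylMeasure ε))
    {χ : ℝ → ℝ} (hχ : Continuous χ) (a : ℂ) (k : ℤ) :
    a • ∫ t, χ t • mode w k t ∂(timeMeasure ε) =
      ∫ p, (χ p.1 * (a * circleExp (-k) p.2).re) • w p ∂(cylMeasure ε) +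
      Complex.I • ∫ p, (χ p.1 * (-Complex.I * (a * circleExp (-k) p.2)).re) • w p
        ∂(cylMeasure ε) := by
  have hc : Continuous fun p : ℝ × ℝ => (χ p.1 : ℂ) * (a * circleExp (-k) p.2) :=
    (Complex.continuous_ofReal.comp (hχ.comp continuous_fst)).mul
      (continuous_const.mul ((continuous_circleExp (-k)).comp continuous_snd))
  have h := integral_complex_smul (μ := cylMeasure ε)
    (fun p : ℝ × ℝ => (χ p.1 : ℂ) * (a * circleExp (-k) p.2)) w
    (integrable_continuous_smul (Complex.continuous_re.comp hc) hw)
    (integrable_continuous_smul (Complex.continuous_im.comp hc) hw)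
  simp only [Complex.re_ofReal_mul, Complex.im_ofReal_mul] at h
  simp only [im_eq_re_neg_I_mul] at h
  rw [← h, ← integral_smul_circleExp_smul hw k hχ, ← integral_smul]
  refine integral_congr_ae (Eventually.of_forall fun p => ?_)
  simp only [← Complex.coe_smul, smul_smul]
  congr 1; ring

theorem circle_integral_smul_eq_re_add_im {f : ℝ → Cn n} (hf : MemLp f 2 circleMeasure)
    (r : ℝ) (k : ℤ) :
    r • ∫ θ, circleExp (-k) θ • f θ ∂circleMeasure =
      ∫ θ, (r * (1 * circleExp (-k) θ).re) • f θ ∂circleMeasure +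
      Complex.I • ∫ θ, (r * (-Complex.I * circleExp (-k) θ).re) • f θ ∂circleMeasure := by
  have hfi := hf.integrable (by norm_num : (1 : ENNReal) ≤ 2)
  have hc : Continuous fun θ : ℝ => (r : ℂ) * circleExp (-k) θ :=
    continuous_const.mul (continuous_circleExp (-k))
  have h := integral_complex_smul (μ := circleMeasure) (fun θ : ℝ => (r : ℂ) * circleExp (-k) θ) f
    (integrable_continuous_smul_time (ε := 2 * Real.pi) (Complex.continuous_re.comp hc) hfi)
    (integrable_continuous_smul_time (ε := 2 * Real.pi) (Complex.continuous_im.comp hc) hfi)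
  simp only [Complex.re_ofReal_mul, Complex.im_ofReal_mul] at h
  simp only [im_eq_re_neg_I_mul] at h
  simp only [one_mul]
  rw [← h, ← integral_smul]
  refine integral_congr_ae (Eventually.of_forall fun p => ?_)
  simp only [← Complex.coe_smul, smul_smul]

namespace LOne

theorem integrable_u (γ : LOne n ε) : Integrable γ.u (cylMeasure ε) :=
  (Lp.memLp γ.u).integrable (by norm_num)

theorem integrable_ut (γ : LOne n ε) : Integrable γ.ut (cylMeasure ε) :=
  (Lp.memLp γ.ut).integrable (by norm_num)

theorem integrable_uθ (γ : LOne n ε) : Integrable γ.uθ (cylMeasure ε) :=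
  (Lp.memLp γ.uθ).integrable (by norm_num)

theorem integral_smul_mode_uθ (γ : LOne n ε) {χ : ℝ → ℝ}
    (hχ : ContDiff ℝ ((⊤ : ℕ∞) : WithTop ℕ∞) χ)
    (h0 : ∃ δ > 0, ∀ t, t ≤ δ ∨ ε - δ ≤ t → χ t = 0) (k : ℤ) :
    ∫ t, χ t • mode γ.uθ k t ∂(timeMeasure ε) =
      (k * Complex.I : ℂ) • ∫ t, χ t • mode γ.u k t ∂(timeMeasure ε) := by
  obtain ⟨δ, hδ, hz⟩ := h0
  have key : ∀ c : ℂ,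
      ∫ p, (χ p.1 * (c * ((-k : ℤ) * Complex.I * circleExp (-k) p.2)).re) • γ.u p ∂(cylMeasure ε) =
        -∫ p, (χ p.1 * (c * circleExp (-k) p.2).re) • γ.uθ p ∂(cylMeasure ε) := by
    intro c
    have h := γ.weak_θ (reTest χ c (-k)) (isSmoothOnCyl_reTest hχ c (-k))
      ⟨δ, hδ, fun t θ ht => by simp [reTest, hz t ht]⟩
    simpa [(hasFDerivAt_reTest hχ c (-k) _).fderiv, reTest] using h
  have e1 := integral_smul_circleExp_eq_re_add_im γ.integrable_u hχ.continuous
    ((-k : ℤ) * Complex.I) k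
  have e2 := integral_smul_circleExp_eq_re_add_im γ.integrable_uθ hχ.continuous 1 k
  have k1 := key 1
  have k2 := key (-Complex.I)
  simp only [one_mul, one_smul] at e2 k1
  rw [k1, k2] at e1
  rw [e2]
  have : (k * Complex.I : ℂ) = -((-k : ℤ) * Complex.I) := by push_cast; ring
  rw [this, neg_smul, e1, smul_neg]
  abel

theorem HasTraces.green_mode {γ : LOne n ε} {f₀ f₁ : ℝ → Cn n} (h : γ.HasTraces f₀ f₁) {χ : ℝ → ℝ}
    (hχ : ContDiff ℝ ((⊤ : ℕ∞) : WithTop ℕ∞) χ) (k : ℤ) :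
    ∫ t, deriv χ t • mode γ.u k t ∂(timeMeasure ε) + ∫ t, χ t • mode γ.ut k t ∂(timeMeasure ε) =
      χ ε • ∫ θ, circleExp (-k) θ • f₁ θ ∂circleMeasure -
        χ 0 • ∫ θ, circleExp (-k) θ • f₀ θ ∂circleMeasure := by
  have hd : Continuous (deriv χ) := hχ.continuous_deriv (by norm_num)
  have hre : ∀ c : ℂ, Continuous fun θ : ℝ => (c * circleExp (-k) θ).re := fun c =>
    Complex.continuous_re.comp (continuous_const.mul (continuous_circleExp (-k)))
  have key : ∀ c : ℂ,
      ∫ p, (deriv χ p.1 * (c * circleExp (-k) p.2).re) • γ.u p ∂(cylMeasure ε) +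
        ∫ p, (χ p.1 * (c * circleExp (-k) p.2).re) • γ.ut p ∂(cylMeasure ε) =
      ∫ θ, (χ ε * (c * circleExp (-k) θ).re) • f₁ θ ∂circleMeasure -
        ∫ θ, (χ 0 * (c * circleExp (-k) θ).re) • f₀ θ ∂circleMeasure := by
    intro c
    have hg := h.green (reTest χ c (-k)) (isSmoothOnCyl_reTest hχ c (-k))
    rw [← integral_add, ← integral_sub]
    · simpa [(hasFDerivAt_reTest hχ c (-k) _).fderiv, reTest, mul_comm] using hg
    · exact integrable_continuous_smul_time (ε := 2 * Real.pi) (continuous_const.mul (hre c))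
        (h.memLp_one.integrable (by norm_num))
    · exact integrable_continuous_smul_time (ε := 2 * Real.pi) (continuous_const.mul (hre c))
        (h.memLp_zero.integrable (by norm_num))
    · exact integrable_continuous_smul ((hd.comp continuous_fst).mul ((hre c).comp continuous_snd))
        γ.integrable_u
    · exact integrable_continuous_smul ((hχ.continuous.comp continuous_fst).mul
        ((hre c).comp continuous_snd)) γ.integrable_ut
  have e1 := integral_smul_circleExp_eq_re_add_im γ.integrable_u hd 1 k
  have e2 := integral_smul_circleExp_eq_re_add_im γ.integrable_ut hχ.continuous 1 k
  have e3 := circle_integral_smul_eq_re_add_im h.memLp_one (χ ε) k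
  have e4 := circle_integral_smul_eq_re_add_im h.memLp_zero (χ 0) k
  have k1 := key 1
  have k2 := key (-Complex.I)
  simp only [one_mul, one_smul] at e1 e2 e3 e4 k1
  rw [e1, e2, e3, e4, add_add_add_comm, k1, ← smul_add, k2, smul_sub]
  abel

end LOne

theorem exists_vanishing_collar {χ : ℝ → ℝ} (h : tsupport χ ⊆ Set.Ioo 0 ε) :
    ∃ δ > 0, ∀ t, t ≤ δ ∨ ε - δ ≤ t → χ t = 0 := by
  have h0 : (tsupport χ)ᶜ ∈ 𝓝 (0 : ℝ) :=
    (isClosed_tsupport χ).isOpen_compl.mem_nhds fun hm => lt_irrefl _ (h hm).1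
  have h1 : (tsupport χ)ᶜ ∈ 𝓝 ε :=
    (isClosed_tsupport χ).isOpen_compl.mem_nhds fun hm => lt_irrefl _ (h hm).2
  obtain ⟨a, ha, ha'⟩ := Metric.mem_nhds_iff.1 h0
  obtain ⟨b, hb, hb'⟩ := Metric.mem_nhds_iff.1 h1
  refine ⟨min a b / 2, by positivity, fun t ht => image_eq_zero_of_notMem_tsupport fun hm => ?_⟩
  have h2 := h hm
  rcases ht with ht | ht
  · refine ha' (?_ : t ∈ Metric.ball 0 a) hm
    rw [Metric.mem_ball, Real.dist_eq, sub_zero, abs_of_pos h2.1]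
    have := min_le_left a b
    linarith
  · refine hb' (?_ : t ∈ Metric.ball ε b) hm
    rw [Metric.mem_ball, Real.dist_eq, abs_of_neg (sub_neg.2 h2.2)]
    have := min_le_right a b
    linarith

/-- Solves the equation adjoint to the mode equation by variation of constants; `τ` is free so that
$\chi$ can vanish at a chosen end. -/
theorem exists_smooth_primitive (κ τ : ℝ) {ψ : ℝ → ℝ}
    (hψ : ContDiff ℝ ((⊤ : ℕ∞) : WithTop ℕ∞) ψ) :
    ∃ χ : ℝ → ℝ, ContDiff ℝ ((⊤ : ℕ∞) : WithTop ℕ∞) χ ∧ χ τ = 0 ∧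
      ∀ t, deriv χ t + κ * χ t = ψ t := by
  have hg : ContDiff ℝ ((⊤ : ℕ∞) : WithTop ℕ∞) fun s => Real.exp (κ * s) * ψ s := by fun_prop
  have hP : ∀ t, HasDerivAt (fun t => ∫ s in τ..t, Real.exp (κ * s) * ψ s)
      (Real.exp (κ * t) * ψ t) t := fun t =>
    intervalIntegral.integral_hasDerivAt_right (hg.continuous.intervalIntegrable _ _)
      hg.continuous.aestronglyMeasurable.stronglyMeasurableAtFilter hg.continuous.continuousAt
  have hPs : ContDiff ℝ ((⊤ : ℕ∞) : WithTop ℕ∞)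
      fun t => ∫ s in τ..t, Real.exp (κ * s) * ψ s := by
    rw [contDiff_infty_iff_deriv]
    refine ⟨fun t => (hP t).differentiableAt, ?_⟩
    rwa [show deriv (fun t => ∫ s in τ..t, Real.exp (κ * s) * ψ s) =
      fun t => Real.exp (κ * t) * ψ t from funext fun t => (hP t).deriv]
  have hE : ContDiff ℝ ((⊤ : ℕ∞) : WithTop ℕ∞) fun s => Real.exp (-κ * s) := by fun_prop
  refine ⟨fun t => Real.exp (-κ * t) * ∫ s in τ..t, Real.exp (κ * s) * ψ s, hE.mul hPs, by simp,
    fun t => ?_⟩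
  have h2 : HasDerivAt (fun t => Real.exp (-κ * t)) (-κ * Real.exp (-κ * t)) t := by
    have := (((hasDerivAt_id t).const_mul (-κ)).exp)
    simpa [mul_comm] using this
  have h3 := (h2.mul (hP t)).deriv
  simp only [Pi.mul_def] at h3
  rw [h3]
  have : Real.exp (-κ * t) * Real.exp (κ * t) = 1 := by rw [← Real.exp_add]; simp
  linear_combination ψ t * this

/-- A duality argument. For any $\psi$ choose $\chi$ with $\chi'+k\chi=\psi$; Green's formula then
expresses $\int\psi u_k$ through boundary terms alone, and these vanish. -/
theorem LOne.eq_zero_of_linear (γ : LOne n ε)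
    (heq : ∀ᵐ p ∂(cylMeasure ε), γ.ut p + Complex.I • γ.uθ p = 0)
    {f₀ f₁ : ℝ → Cn n} (htr : γ.HasTraces f₀ f₁)
    (h₀ : ∀ k ≤ 0, ∫ θ, circleExp (-k) θ • f₀ θ ∂circleMeasure = 0)
    (h₁ : ∀ k > 0, ∫ θ, circleExp (-k) θ • f₁ θ ∂circleMeasure = 0) :
    γ.u = 0 ∧ γ.ut = 0 ∧ γ.uθ = 0 := by
  have hint : ∀ {χ : ℝ → ℝ}, Continuous χ → ∀ {w : ℝ × ℝ → Cn n}, Integrable w (cylMeasure ε) →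
      ∀ k, Integrable (fun t => χ t • mode w k t) (timeMeasure ε) := fun hχ _ hw k =>
    integrable_continuous_smul_time hχ (integrable_mode hw k)
  -- The weak $\theta$-derivative is tested only against functions vanishing near the ends. The
  -- relation between modes is therefore made pointwise first, so that it can be integrated against
  -- any continuous $\chi$.
  have hθ : ∀ k : ℤ, ∀ᵐ t ∂(timeMeasure ε),
      mode γ.uθ k t = (k * Complex.I : ℂ) • mode γ.u k t := by
    intro k
    have i1 := integrable_mode γ.integrable_uθ k
    have i2 : Integrable (fun t => (k * Complex.I : ℂ) • mode γ.u k t) (timeMeasure ε) :=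
      (integrable_mode γ.integrable_u k).smul (k * Complex.I : ℂ)
    have := ae_eq_zero_of_timeMeasure (i1.sub i2) fun χ hχ hsub => by
      have h := γ.integral_smul_mode_uθ hχ (exists_vanishing_collar hsub) k
      have j1 := hint hχ.continuous γ.integrable_uθ k
      have j2 : Integrable (fun t => χ t • (k * Complex.I : ℂ) • mode γ.u k t) (timeMeasure ε) :=
        integrable_continuous_smul_time hχ.continuous i2
      simp only [Pi.sub_apply, smul_sub]
      rw [integral_sub j1 j2, h, ← integral_smul, sub_eq_zero]
      simp only [smul_comm (k * Complex.I : ℂ)]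
    filter_upwards [this] with t ht
    exact sub_eq_zero.1 ht
  have ht : ∀ (k : ℤ) {χ : ℝ → ℝ}, Continuous χ → ∫ t, χ t • mode γ.ut k t ∂(timeMeasure ε) =
      (k : ℂ) • ∫ t, χ t • mode γ.u k t ∂(timeMeasure ε) := by
    intro k χ hχ
    have h1 : ∫ t, χ t • mode γ.ut k t ∂(timeMeasure ε) =
        (-Complex.I) • ∫ t, χ t • mode γ.uθ k t ∂(timeMeasure ε) := by
      rw [← integral_smul_circleExp_smul γ.integrable_ut k hχ,
        ← integral_smul_circleExp_smul γ.integrable_uθ k hχ, ← integral_smul]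
      refine integral_congr_ae ?_
      filter_upwards [heq] with p hp
      rw [eq_neg_of_add_eq_zero_left hp, ← neg_smul, smul_comm (circleExp _ _), smul_comm (χ _)]
    have h2 : ∫ t, χ t • mode γ.uθ k t ∂(timeMeasure ε) =
        (k * Complex.I : ℂ) • ∫ t, χ t • mode γ.u k t ∂(timeMeasure ε) := by
      rw [← integral_smul]
      refine integral_congr_ae ?_
      filter_upwards [hθ k] with t ht
      rw [ht, smul_comm]
    rw [h1, h2, smul_smul]
    congr 1
    linear_combination (-(k : ℂ)) * Complex.I_mul_I
  have hu : ∀ k, mode γ.u k =ᵐ[timeMeasure ε] 0 := by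
    intro k
    refine ae_eq_zero_of_timeMeasure (integrable_mode γ.integrable_u k) fun ψ hψ _ => ?_
    -- $\chi$ vanishes at the end where the trace of this mode is not prescribed; at the other end
    -- the trace itself is zero.
    obtain ⟨χ, hχ, hχ0, hχd⟩ := exists_smooth_primitive (k : ℝ) (if k ≤ 0 then ε else 0) hψ
    have hg := htr.green_mode hχ k
    have hb : χ ε • ∫ θ, circleExp (-k) θ • f₁ θ ∂circleMeasure -
        χ 0 • ∫ θ, circleExp (-k) θ • f₀ θ ∂circleMeasure = 0 := by
      by_cases hk : k ≤ 0
      · rw [if_pos hk] at hχ0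
        rw [hχ0, h₀ k hk, zero_smul, smul_zero, sub_zero]
      · rw [if_neg hk] at hχ0
        rw [hχ0, h₁ k (not_le.1 hk), zero_smul, smul_zero, sub_zero]
    have hd : Continuous (deriv χ) := hχ.continuous_deriv (by norm_num)
    have j1 := hint hd γ.integrable_u k
    have j2 : Integrable (fun t => (k : ℂ) • χ t • mode γ.u k t) (timeMeasure ε) :=
      (hint hχ.continuous γ.integrable_u k).smul (k : ℂ)
    rw [hb, ht k hχ.continuous, ← integral_smul, ← integral_add j1 j2] at hg
    rw [← hg]
    refine integral_congr_ae (Eventually.of_forall fun t => ?_)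
    simp only [← hχd t, ← Complex.coe_smul, smul_smul, ← add_smul]
    congr 1
    push_cast; ring
  have hu0 : γ.u = 0 := Lp.eq_zero_iff_ae_eq_zero.2 (ae_eq_zero_of_mode (Lp.memLp γ.u) hu)
  have hθ0 : γ.uθ = 0 := by
    refine Lp.eq_zero_iff_ae_eq_zero.2 (ae_eq_zero_of_mode (Lp.memLp γ.uθ) fun k => ?_)
    filter_upwards [hu k, hθ k] with t h1 h2
    rw [h2, h1]; simp
  refine ⟨hu0, Lp.eq_zero_iff_ae_eq_zero.2 ?_, hθ0⟩
  filter_upwards [heq, Lp.eq_zero_iff_ae_eq_zero.1 hθ0] with p h1 h2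
  rw [h2] at h1
  simpa using h1

/-! ### Differences of solutions -/

theorem IsWeakDeriv.sub {e : ℝ × ℝ} {u₁ w₁ u₂ w₂ : Lp (Cn n) 2 (cylMeasure ε)}
    (h₁ : IsWeakDeriv ε e u₁ w₁) (h₂ : IsWeakDeriv ε e u₂ w₂) :
    IsWeakDeriv ε e (u₁ - u₂ : Lp (Cn n) 2 (cylMeasure ε)) (w₁ - w₂ : Lp (Cn n) 2 (cylMeasure ε)) := by
  intro φ hφ hc
  have key : ∀ (ψ : ℝ × ℝ → ℝ), Continuous ψ → ∀ f g : Lp (Cn n) 2 (cylMeasure ε),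
      ∫ p, ψ p • (f - g : Lp (Cn n) 2 (cylMeasure ε)) p ∂(cylMeasure ε) =
        ∫ p, ψ p • f p ∂(cylMeasure ε) - ∫ p, ψ p • g p ∂(cylMeasure ε) := by
    intro ψ hψ f g
    rw [← integral_sub (integrable_continuous_smul hψ ((Lp.memLp f).integrable (by norm_num)))
      (integrable_continuous_smul hψ ((Lp.memLp g).integrable (by norm_num)))]
    refine integral_congr_ae ?_
    filter_upwards [Lp.coeFn_sub f g] with p hp
    rw [hp, Pi.sub_apply, smul_sub]
  rw [key _ (hφ.continuous_fderiv_apply e), key _ hφ.continuous, h₁ φ hφ hc, h₂ φ hφ hc]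
  abel

namespace LOne

/-- The difference of two maps in `L²_1`. -/
def sub (γ₁ γ₂ : LOne n ε) : LOne n ε where
  u := γ₁.u - γ₂.u
  ut := γ₁.ut - γ₂.ut
  uθ := γ₁.uθ - γ₂.uθ
  weak_t := γ₁.weak_t.sub γ₂.weak_t
  weak_θ := γ₁.weak_θ.sub γ₂.weak_θ

theorem ext_components {γ₁ γ₂ : LOne n ε} (h : γ₁.u = γ₂.u) (ht : γ₁.ut = γ₂.ut)
    (hθ : γ₁.uθ = γ₂.uθ) : γ₁ = γ₂ := by
  cases γ₁; cases γ₂; simp only at h ht hθ; subst h ht hθ; rfl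

theorem HasTraces.sub {γ₁ γ₂ : LOne n ε} {f₀ f₁ g₀ g₁ : ℝ → Cn n} (h₁ : γ₁.HasTraces f₀ f₁)
    (h₂ : γ₂.HasTraces g₀ g₁) : (γ₁.sub γ₂).HasTraces (f₀ - g₀) (f₁ - g₁) where
  memLp_zero := h₁.memLp_zero.sub h₂.memLp_zero
  memLp_one := h₁.memLp_one.sub h₂.memLp_one
  green φ hφ := by
    have hd := hφ.continuous_fderiv_apply (1, 0)
    have hsl : ∀ t : ℝ, Continuous fun θ => φ (t, θ) := fun t =>
      hφ.continuous.comp (Continuous.prodMk_right t)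
    have ic : ∀ γ : LOne n ε, Integrable
        (fun p => fderiv ℝ φ p (1, 0) • γ.u p + φ p • γ.ut p) (cylMeasure ε) := fun γ =>
      (integrable_continuous_smul hd γ.integrable_u).add
        (integrable_continuous_smul hφ.continuous γ.integrable_ut)
    have ib : ∀ {f₀ f₁ : ℝ → Cn n}, MemLp f₀ 2 circleMeasure → MemLp f₁ 2 circleMeasure →
        Integrable (fun θ => φ (ε, θ) • f₁ θ - φ (0, θ) • f₀ θ) circleMeasure :=
      fun hf₀ hf₁ => (integrable_continuous_smul_time (ε := 2 * Real.pi) (hsl ε)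
        (hf₁.integrable (by norm_num))).sub (integrable_continuous_smul_time (ε := 2 * Real.pi)
        (hsl 0) (hf₀.integrable (by norm_num)))
    have hL : ∫ p, (fderiv ℝ φ p (1, 0) • (γ₁.sub γ₂).u p + φ p • (γ₁.sub γ₂).ut p)
        ∂(cylMeasure ε) = ∫ p, (fderiv ℝ φ p (1, 0) • γ₁.u p + φ p • γ₁.ut p) ∂(cylMeasure ε) -
          ∫ p, (fderiv ℝ φ p (1, 0) • γ₂.u p + φ p • γ₂.ut p) ∂(cylMeasure ε) := by
      rw [← integral_sub (ic γ₁) (ic γ₂)]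
      refine integral_congr_ae ?_
      filter_upwards [Lp.coeFn_sub γ₁.u γ₂.u, Lp.coeFn_sub γ₁.ut γ₂.ut] with p h1 h2
      simp only [LOne.sub, h1, h2, Pi.sub_apply, smul_sub]
      abel
    rw [hL, h₁.green φ hφ, h₂.green φ hφ, ← integral_sub (ib h₁.memLp_zero h₁.memLp_one)
      (ib h₂.memLp_zero h₂.memLp_one)]
    refine integral_congr_ae (Eventually.of_forall fun θ => ?_)
    simp only [Pi.sub_apply, smul_sub]
    abel

/-- `γ` solves the linear equation `∂_t u + J ∂_θ u = F`. -/
def SolvesLinear (γ : LOne n ε) (F : ℝ × ℝ → Cn n) : Prop :=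
  ∀ᵐ p ∂(cylMeasure ε), γ.ut p + Complex.I • γ.uθ p = F p

theorem SolvesLinear.sub {γ₁ γ₂ : LOne n ε} {F₁ F₂ : Lp (Cn n) 2 (cylMeasure ε)}
    (h₁ : γ₁.SolvesLinear F₁) (h₂ : γ₂.SolvesLinear F₂) :
    (γ₁.sub γ₂).SolvesLinear (F₁ - F₂ : Lp (Cn n) 2 (cylMeasure ε)) := by
  filter_upwards [h₁, h₂, Lp.coeFn_sub F₁ F₂, Lp.coeFn_sub γ₁.ut γ₂.ut,
    Lp.coeFn_sub γ₁.uθ γ₂.uθ] with p a1 a2 a3 a4 a5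
  simp only [LOne.sub, a3, a4, a5, Pi.sub_apply, smul_sub, ← a1, ← a2]
  abel

/-- The boundary data of `γ` in the orthonormal basis of exponentials: the coefficients of
the trace at `0` for the nonnegative spectrum of `L`, and at `ε` for the negative one. -/
def HasModeBoundary (γ : LOne n ε) (y : ℤ → Cn n) : Prop :=
  ∃ f₀ f₁ : ℝ → Cn n, γ.HasTraces f₀ f₁ ∧
    (∀ k ≤ 0, ∫ θ, circleExp (-k) θ • f₀ θ ∂circleMeasure = y k) ∧
    ∀ k > 0, ∫ θ, circleExp (-k) θ • f₁ θ ∂circleMeasure = y k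

theorem HasModeBoundary.sub {γ₁ γ₂ : LOne n ε} {y₁ y₂ : ℤ → Cn n}
    (h₁ : γ₁.HasModeBoundary y₁) (h₂ : γ₂.HasModeBoundary y₂) :
    (γ₁.sub γ₂).HasModeBoundary (y₁ - y₂) := by
  obtain ⟨f₀, f₁, hf, a0, a1⟩ := h₁
  obtain ⟨g₀, g₁, hg, b0, b1⟩ := h₂
  have key : ∀ {f g : ℝ → Cn n}, MemLp f 2 circleMeasure → MemLp g 2 circleMeasure → ∀ k,
      ∫ θ, circleExp (-k) θ • (f - g) θ ∂circleMeasure =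
        ∫ θ, circleExp (-k) θ • f θ ∂circleMeasure -
          ∫ θ, circleExp (-k) θ • g θ ∂circleMeasure := by
    intro f g hf hg k
    simp only [Pi.sub_apply, smul_sub]
    exact integral_sub (integrable_circleExp_smul (hf.integrable (by norm_num)) _)
      (integrable_circleExp_smul (hg.integrable (by norm_num)) _)
  refine ⟨f₀ - g₀, f₁ - g₁, hf.sub hg, fun k hk => ?_, fun k hk => ?_⟩
  · rw [key hf.memLp_zero hg.memLp_zero, a0 k hk, b0 k hk]; rfl
  · rw [key hf.memLp_one hg.memLp_one, a1 k hk, b1 k hk]; rfl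

theorem SolvesLinear.unique {γ₁ γ₂ : LOne n ε} {F : Lp (Cn n) 2 (cylMeasure ε)} {y : ℤ → Cn n}
    (h₁ : γ₁.SolvesLinear F) (h₂ : γ₂.SolvesLinear F)
    (hy₁ : γ₁.HasModeBoundary y) (hy₂ : γ₂.HasModeBoundary y) : γ₁ = γ₂ := by
  have h := h₁.sub h₂
  rw [sub_self] at h
  obtain ⟨f₀, f₁, hf, a0, a1⟩ := hy₁.sub hy₂
  rw [sub_self] at a0 a1
  obtain ⟨e1, e2, e3⟩ := (γ₁.sub γ₂).eq_zero_of_linear (by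
    filter_upwards [h, Lp.coeFn_zero (Cn n) 2 (cylMeasure ε)] with p hp h0
    rw [hp, h0]; rfl) hf a0 a1
  exact ext_components (sub_eq_zero.1 e1) (sub_eq_zero.1 e2) (sub_eq_zero.1 e3)

/-- The difference has zero boundary data, so by uniqueness it is the solution constructed in
`exists_linear_solution` and inherits that estimate. Bounding $u$ alone suffices for the
contraction. -/
theorem SolvesLinear.norm_sub_sq_le (hε : 0 < ε) {γ₁ γ₂ : LOne n ε}
    {F₁ F₂ : Lp (Cn n) 2 (cylMeasure ε)} {y : ℤ → Cn n}
    (h₁ : γ₁.SolvesLinear F₁) (h₂ : γ₂.SolvesLinear F₂)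
    (hy₁ : γ₁.HasModeBoundary y) (hy₂ : γ₂.HasModeBoundary y) :
    ‖γ₁.u - γ₂.u‖ ^ 2 ≤ 2 * ε ^ 2 * ‖F₁ - F₂‖ ^ 2 := by
  obtain ⟨γ, hγ, hb, hu, -⟩ := exists_linear_solution hε (F₁ - F₂) (0 : ℤ → Cn n)
    (by simp) (by simp)
  have hbd := hy₁.sub hy₂
  rw [sub_self] at hbd
  have : γ₁.sub γ₂ = γ := (h₁.sub h₂).unique hγ hbd hb
  rw [← this] at hu
  simpa [LOne.sub] using hu

/-- The boundary data in the basis of exponentials of a mixed boundary value `b`. -/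
def modeBoundary (b : ℝ → Cn n) (k : ℤ) : Cn n :=
  Real.sqrt (2 * Real.pi) • if k ≤ 0 then -loopCoeff b k else loopCoeff b k

theorem norm_sq_modeBoundary (b : ℝ → Cn n) (k : ℤ) :
    ‖modeBoundary b k‖ ^ 2 = 2 * Real.pi * ‖loopCoeff b k‖ ^ 2 := by
  rw [modeBoundary, norm_smul, mul_pow, Real.norm_of_nonneg (Real.sqrt_nonneg _),
    Real.sq_sqrt Real.two_pi_pos.le]
  split_ifs <;> simp

/-- The eigenvalue on $e^{ik\theta}$ is $-k$, so for each $k$ exactly one projection survives: the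
trace at $0$, with a minus sign, if $k\le0$, and the trace at $\epsilon$ if $k>0$. -/
theorem hasMixedBoundaryValue_iff (γ : LOne n ε) (b : ℝ → Cn n) :
    γ.HasMixedBoundaryValue b ↔ γ.HasModeBoundary (modeBoundary b) := by
  have hs : Real.sqrt (2 * Real.pi) ≠ 0 := by positivity
  have key : ∀ (f₀ f₁ : ℝ → Cn n), (∀ k, specMinus f₁ k - specPlus f₀ k = loopCoeff b k) ↔
      (∀ k ≤ 0, ∫ θ, circleExp (-k) θ • f₀ θ ∂circleMeasure = modeBoundary b k) ∧
      ∀ k > 0, ∫ θ, circleExp (-k) θ • f₁ θ ∂circleMeasure = modeBoundary b k := by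
    intro f₀ f₁
    have hneg : ∀ k : ℤ, (0 ≤ eigL k ↔ k ≤ 0) ∧ (eigL k < 0 ↔ 0 < k) := fun k => by
      simp [eigL]
    have e1 : ∀ k ≤ 0, specMinus f₁ k - specPlus f₀ k = -loopCoeff f₀ k := fun k hk => by
      simp [specMinus, specPlus, (hneg k).1, (hneg k).2, hk, not_lt.2 hk]
    have e2 : ∀ k > 0, specMinus f₁ k - specPlus f₀ k = loopCoeff f₁ k := fun k hk => by
      simp [specMinus, specPlus, (hneg k).1, (hneg k).2, hk, not_le.2 hk]
    simp only [integral_circleExp_smul, modeBoundary, smul_right_inj hs]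
    constructor
    · intro h
      refine ⟨fun k hk => ?_, fun k hk => ?_⟩
      · rw [if_pos hk, ← h k, e1 k hk, neg_neg]
      · rw [if_neg (not_le.2 hk), ← h k, e2 k hk]
    · rintro ⟨h1, h2⟩ k
      by_cases hk : k ≤ 0
      · rw [e1 k hk, h1 k hk, if_pos hk, neg_neg]
      · rw [e2 k (not_le.1 hk), h2 k (not_le.1 hk), if_neg hk]
  simp only [HasMixedBoundaryValue, HasModeBoundary, key]

theorem summable_modeBoundary {b : ℝ → Cn n} (hb : MemLHalf b) :
    Summable fun k => ‖modeBoundary b k‖ ^ 2 := by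
  simp only [norm_sq_modeBoundary]
  exact hb.summable_sq.mul_left _

theorem summable_abs_mul_modeBoundary {b : ℝ → Cn n} (hb : MemLHalf b) :
    Summable fun k : ℤ => |(k : ℝ)| * ‖modeBoundary b k‖ ^ 2 := by
  simp only [norm_sq_modeBoundary, mul_left_comm _ (2 * Real.pi)]
  exact hb.2.mul_left _

end LOne

/-- Each weight is at most $k^2\epsilon$ and so tends to $0$, while the bound $2|k|$ dominates the
sum; its summability is the $L^2_{1/2}$ condition. -/
theorem tendsto_tsum_modeWeight {y : ℤ → Cn n}
    (hy : Summable fun k : ℤ => |(k : ℝ)| * ‖y k‖ ^ 2) :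
    Tendsto (fun ε => ∑' k, modeWeight ε k * ‖y k‖ ^ 2) (𝓝[>] 0) (𝓝 0) := by
  have h := tendsto_tsum_of_dominated_convergence (𝓕 := 𝓝[>] (0 : ℝ))
    (f := fun ε k => modeWeight ε k * ‖y k‖ ^ 2) (g := fun _ => (0 : ℝ)) (hy.mul_left 2) ?_ ?_
  · simpa using h
  · intro k
    have hc : Continuous fun ε => modeWeight ε k * ‖y k‖ ^ 2 := by
      unfold modeWeight; fun_prop
    have h0 : modeWeight 0 k * ‖y k‖ ^ 2 = 0 := by simp [modeWeight]
    have := hc.tendsto 0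
    rw [h0] at this
    exact this.mono_left nhdsWithin_le_nhds
  · filter_upwards [self_mem_nhdsWithin] with ε hε k
    have hε' : (0 : ℝ) < ε := hε
    rw [Real.norm_of_nonneg (mul_nonneg (modeWeight_nonneg hε'.le k) (sq_nonneg _)), ← mul_assoc]
    exact mul_le_mul_of_nonneg_right (modeWeight_le ε k) (sq_nonneg _)

/-! ### The Hamiltonian vector field as a Lipschitz map of `L²` -/

/-- A continuous vector field, Lipschitz in the space variable and bounded at the origin,
uniformly over the circle. -/
structure LipschitzField (X : Cn n → ℝ → Cn n) (K M : ℝ) : Prop where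
  K_nonneg : 0 ≤ K
  continuous : Continuous fun p : Cn n × ℝ => X p.1 p.2
  lipschitz : ∀ θ ∈ Set.Icc 0 (2 * Real.pi), ∀ x y, ‖X x θ - X y θ‖ ≤ K * ‖x - y‖
  bound : ∀ θ ∈ Set.Icc 0 (2 * Real.pi), ‖X 0 θ‖ ≤ M

theorem AdmissibleHamiltonian.exists_lipschitzField {H : Cn n → ℝ → ℝ}
    (hH : AdmissibleHamiltonian H) : ∃ K M, LipschitzField (hamVF H) K M := by
  obtain ⟨a, R, Xc, hXc, hsupp, hdec⟩ := hH.decomposition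
  have hcont : Continuous fun p : Cn n × ℝ => hamVF H p.1 p.2 := by
    simp only [hdec]
    exact (continuous_fst.const_smul ((a : ℂ) * Complex.I)).add hXc.continuous
  set G : Cn n × ℝ → Cn n := fun p => Xc p.1 p.2 with hG
  obtain ⟨C, hC⟩ := ((isCompact_closedBall (0 : Cn n) R).prod
    (isCompact_Icc (a := (0 : ℝ)) (b := 2 * Real.pi))).exists_bound_of_continuousOn
    (hXc.continuous_fderiv (by norm_num)).continuousOn
  obtain ⟨M, hM⟩ := (isCompact_Icc (a := (0 : ℝ)) (b := 2 * Real.pi)).exists_bound_of_continuousOn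
    (hcont.comp (Continuous.prodMk_right (0 : Cn n))).continuousOn
  -- The absolute value is needed because the ball is empty for $R<0$, and then nothing forces
  -- $C\ge0$.
  have hlip : ∀ θ ∈ Set.Icc 0 (2 * Real.pi), ∀ x y, ‖Xc x θ - Xc y θ‖ ≤ |C| * ‖x - y‖ := by
    intro θ hθ x y
    have hder : ∀ x, HasFDerivAt (fun x => Xc x θ)
        ((fderiv ℝ G (x, θ)).comp (ContinuousLinearMap.inl ℝ (Cn n) ℝ)) x := fun x =>
      HasFDerivAt.comp (g := G) (f := fun x : Cn n => (x, θ)) x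
        ((hXc.differentiable (by norm_num)) (x, θ)).hasFDerivAt (hasFDerivAt_prodMk_left x θ)
    refine Convex.norm_image_sub_le_of_norm_fderiv_le (𝕜 := ℝ) (s := Set.univ)
      (f := fun x => Xc x θ)
      (fun z _ => (hder z).differentiableAt) (fun z _ => ?_) convex_univ trivial trivial
    by_cases hz : ‖z‖ ≤ R
    · rw [(hder z).fderiv]
      refine (ContinuousLinearMap.opNorm_comp_le _ _).trans ?_
      have h1 := hC (z, θ) ⟨by simpa using hz, hθ⟩
      have h2 := ContinuousLinearMap.norm_inl_le_one ℝ (Cn n) ℝ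
      calc _ ≤ |C| * 1 := mul_le_mul (h1.trans (le_abs_self C)) h2 (norm_nonneg _) (abs_nonneg _)
        _ = _ := mul_one _
    · have h0 : (fun x => Xc x θ) =ᶠ[𝓝 z] fun _ => 0 := by
        filter_upwards [(isOpen_lt continuous_const continuous_norm).mem_nhds
          (show R < ‖z‖ from not_le.1 hz)] with w hw
        exact hsupp w θ (le_of_lt hw)
      rw [h0.fderiv_eq]
      simp
  refine ⟨|a| + |C|, M, by positivity, hcont, fun θ hθ x y => ?_, fun θ hθ => hM θ hθ⟩
  have e : hamVF H x θ - hamVF H y θ = ((a : ℂ) * Complex.I) • (x - y) + (Xc x θ - Xc y θ) := by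
    rw [hdec, hdec, smul_sub]; abel
  rw [e, add_mul]
  refine (norm_add_le _ _).trans (add_le_add ?_ (hlip θ hθ x y))
  rw [norm_smul]; simp

namespace LipschitzField

variable {X : Cn n → ℝ → Cn n} {K M : ℝ}

theorem memLp_comp (hX : LipschitzField X K M) (u : Lp (Cn n) 2 (cylMeasure ε)) :
    MemLp (fun p => Complex.I • X (u p) p.2) 2 (cylMeasure ε) := by
  have hb : MemLp (fun p => K * ‖u p‖ + M) 2 (cylMeasure ε) :=
    ((Lp.memLp u).norm.const_mul K).add (memLp_const M)
  refine MemLp.of_le hb ?_ ?_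
  · exact (hX.continuous.comp_aestronglyMeasurable
      ((Lp.aestronglyMeasurable u).prodMk
        continuous_snd.aestronglyMeasurable)).const_smul Complex.I
  · filter_upwards [ae_mem_cylMeasure ε] with p hp
    have hθ := Set.Ioo_subset_Icc_self hp.2
    have h1 := hX.lipschitz p.2 hθ (u p) 0
    have h2 := hX.bound p.2 hθ
    have h3 := norm_sub_norm_le (X (u p) p.2) (X 0 p.2)
    rw [sub_zero] at h1
    rw [norm_smul, Complex.norm_I, one_mul]
    exact le_trans (by linarith) (le_abs_self _)

/-- The map `u ↦ J X(u, θ)` of `L²`. -/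
def toLp (hX : LipschitzField X K M) (u : Lp (Cn n) 2 (cylMeasure ε)) :
    Lp (Cn n) 2 (cylMeasure ε) := (hX.memLp_comp u).toLp _

theorem coeFn_toLp (hX : LipschitzField X K M) (u : Lp (Cn n) 2 (cylMeasure ε)) :
    hX.toLp u =ᵐ[cylMeasure ε] fun p => Complex.I • X (u p) p.2 :=
  (hX.memLp_comp u).coeFn_toLp

theorem norm_toLp_sub_le (hX : LipschitzField X K M) (u v : Lp (Cn n) 2 (cylMeasure ε)) :
    ‖hX.toLp u - hX.toLp v‖ ≤ K * ‖u - v‖ := by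
  refine Lp.norm_le_mul_norm_of_ae_le_mul ?_
  filter_upwards [Lp.coeFn_sub (hX.toLp u) (hX.toLp v), Lp.coeFn_sub u v, hX.coeFn_toLp u,
    hX.coeFn_toLp v, ae_mem_cylMeasure ε] with p h1 h2 h3 h4 h5
  rw [h1, h2, Pi.sub_apply, Pi.sub_apply, h3, h4, ← smul_sub, norm_smul, Complex.norm_I, one_mul]
  exact hX.lipschitz p.2 (Set.Ioo_subset_Icc_self h5.2) _ _

theorem norm_toLp_zero_sq_le (hX : LipschitzField X K M) (hε : 0 ≤ ε) :
    ‖hX.toLp (0 : Lp (Cn n) 2 (cylMeasure ε))‖ ^ 2 ≤ 2 * Real.pi * ε * M ^ 2 := by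
  rw [norm_sq_eq_integral]
  have hvol : (cylMeasure ε).real Set.univ = 2 * Real.pi * ε := by
    rw [cylMeasure_eq_prod, Measure.real, Measure.prod_apply MeasurableSet.univ]
    simp [timeMeasure, circleMeasure, ENNReal.toReal_mul, hε, Real.pi_pos.le]
  have h : ∫ p, ‖hX.toLp (0 : Lp (Cn n) 2 (cylMeasure ε)) p‖ ^ 2 ∂(cylMeasure ε) ≤
      ∫ _, M ^ 2 ∂(cylMeasure ε) := by
    refine integral_mono_of_nonneg (Eventually.of_forall fun _ => sq_nonneg _)
      (integrable_const _) ?_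
    filter_upwards [hX.coeFn_toLp 0, Lp.coeFn_zero (Cn n) 2 (cylMeasure ε),
      ae_mem_cylMeasure ε] with p h1 h2 h3
    rw [h1, h2, norm_smul, Complex.norm_I, one_mul]
    exact pow_le_pow_left₀ (norm_nonneg _) (hX.bound p.2 (Set.Ioo_subset_Icc_self h3.2)) 2
  simpa [hvol] using h

theorem norm_toLp_sq_le (hX : LipschitzField X K M) (hε : 0 ≤ ε)
    (u : Lp (Cn n) 2 (cylMeasure ε)) :
    ‖hX.toLp u‖ ^ 2 ≤ 2 * K ^ 2 * ‖u‖ ^ 2 + 4 * Real.pi * ε * M ^ 2 := by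
  have h1 := hX.norm_toLp_sub_le u 0
  have h2 := hX.norm_toLp_zero_sq_le hε
  rw [sub_zero] at h1
  have h3 : ‖hX.toLp u‖ ≤ K * ‖u‖ + ‖hX.toLp (0 : Lp (Cn n) 2 (cylMeasure ε))‖ := by
    have := norm_sub_norm_le (hX.toLp u) (hX.toLp 0)
    linarith
  have h4 := pow_le_pow_left₀ (norm_nonneg _) h3 2
  have h5 := add_sq_le (a := K * ‖u‖) (b := ‖hX.toLp (0 : Lp (Cn n) 2 (cylMeasure ε))‖)
  rw [mul_pow] at h5
  linarith

end LipschitzField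

/-! ### The perturbed holomorphic curve equation -/

variable {H : Cn n → ℝ → ℝ} {K M : ℝ}

theorem LOne.isPerturbedHolomorphic_iff (hX : LipschitzField (hamVF H) K M) (γ : LOne n ε) :
    γ.IsPerturbedHolomorphic H ↔ γ.SolvesLinear (hX.toLp γ.u) := by
  refine eventually_congr ?_
  filter_upwards [hX.coeFn_toLp γ.u] with p hp
  rw [hp, smul_sub, ← add_sub_assoc, sub_eq_zero]

/-- As $J$ is an isometry, the equation makes the two energy densities equal almost everywhere. -/
theorem LOne.IsPerturbedHolomorphic.energy_eq {γ : LOne n ε} (h : γ.IsPerturbedHolomorphic H) :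
    γ.energy H = ‖γ.ut‖ ^ 2 := by
  rw [LOne.energy, norm_sq_eq_integral, ← integral_const_mul]
  refine integral_congr_ae ?_
  filter_upwards [h] with p hp
  have : ‖γ.uθ p - hamVF H (γ.u p) p.2‖ = ‖γ.ut p‖ := by
    rw [eq_neg_of_add_eq_zero_left hp, norm_neg, norm_smul, Complex.norm_I, one_mul]
  simp only [this]
  ring

/-- The threshold gives $\epsilon K\le1/4$; `K + 1` keeps the denominator positive when $K=0$. -/
theorem two_mul_sq_mul_sq_le (hK : 0 ≤ K) (hε : 0 < ε) (hεK : ε ≤ 1 / (4 * (K + 1))) :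
    2 * ε ^ 2 * K ^ 2 ≤ 1 / 8 := by
  have h1 : ε * K ≤ 1 / 4 := by
    rw [le_div_iff₀ (by positivity)] at hεK
    nlinarith
  have h2 := pow_le_pow_left₀ (by positivity) h1 2
  nlinarith

/-- The linear estimate and the Lipschitz bound give $\|u_1-u_2\|^2\le\frac18\|u_1-u_2\|^2$. Once
the maps agree, both solve the same linear equation, so their weak derivatives agree too. -/
theorem LOne.isPerturbedHolomorphic_unique (hX : LipschitzField (hamVF H) K M) (hε : 0 < ε)
    (hεK : ε ≤ 1 / (4 * (K + 1))) {b : ℝ → Cn n} {γ₁ γ₂ : LOne n ε}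
    (h₁ : γ₁.IsPerturbedHolomorphic H) (h₂ : γ₂.IsPerturbedHolomorphic H)
    (hb₁ : γ₁.HasMixedBoundaryValue b) (hb₂ : γ₂.HasMixedBoundaryValue b) : γ₁ = γ₂ := by
  rw [LOne.isPerturbedHolomorphic_iff hX] at h₁ h₂
  rw [LOne.hasMixedBoundaryValue_iff] at hb₁ hb₂
  have h := h₁.norm_sub_sq_le hε h₂ hb₁ hb₂
  have hl := pow_le_pow_left₀ (norm_nonneg _) (hX.norm_toLp_sub_le γ₁.u γ₂.u) 2
  have hc := two_mul_sq_mul_sq_le hX.K_nonneg hε hεK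
  have h0 : ‖γ₁.u - γ₂.u‖ ^ 2 ≤ 0 := by
    have h3 := mul_le_mul_of_nonneg_left hl (by positivity : 0 ≤ 2 * ε ^ 2)
    have h4 := mul_le_mul_of_nonneg_right hc (sq_nonneg ‖γ₁.u - γ₂.u‖)
    rw [mul_pow] at h3
    nlinarith
  have hu : γ₁.u = γ₂.u := by
    rw [← sub_eq_zero, ← norm_eq_zero]
    exact pow_eq_zero_iff two_ne_zero |>.1 (le_antisymm h0 (sq_nonneg _))
  rw [← hu] at h₂
  exact h₁.unique h₂ hb₁ hb₂

theorem LOne.exists_isPerturbedHolomorphic (hX : LipschitzField (hamVF H) K M) (hε : 0 < ε)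
    (hεK : ε ≤ 1 / (4 * (K + 1))) {b : ℝ → Cn n} (hb : MemLHalf b) :
    ∃ γ : LOne n ε, γ.IsPerturbedHolomorphic H ∧ γ.HasMixedBoundaryValue b ∧
      γ.energy H ≤ 4 * ∑' k, modeWeight ε k * ‖modeBoundary b k‖ ^ 2 +
        ε * (18 * (8 * K ^ 2 * ∑' k, ‖modeBoundary b k‖ ^ 2 + 8 * Real.pi * M ^ 2)) := by
  choose S hS hSb hSu hSθ using fun F : Lp (Cn n) 2 (cylMeasure ε) =>
    exists_linear_solution hε F (modeBoundary b) (summable_modeBoundary hb)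
      (summable_abs_mul_modeBoundary hb)
  have hc := two_mul_sq_mul_sq_le hX.K_nonneg hε hεK
  -- The squared Lipschitz constant is at most $2\epsilon^2K^2\le1/8$, below $(1/2)^2$.
  have hcontr : ContractingWith (1 / 2) fun u => (S (hX.toLp u)).u := by
    refine ⟨by rw [← NNReal.coe_lt_coe]; norm_num, LipschitzWith.of_dist_le_mul fun u v => ?_⟩
    rw [dist_eq_norm, dist_eq_norm]
    refine le_of_sq_le_sq ?_ (by positivity)
    have h := SolvesLinear.norm_sub_sq_le hε (hS (hX.toLp u)) (hS (hX.toLp v))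
      (hSb (hX.toLp u)) (hSb (hX.toLp v))
    have hl := pow_le_pow_left₀ (norm_nonneg _) (hX.norm_toLp_sub_le u v) 2
    have h3 := mul_le_mul_of_nonneg_left hl (by positivity : 0 ≤ 2 * ε ^ 2)
    have h4 := mul_le_mul_of_nonneg_right hc (sq_nonneg ‖u - v‖)
    have h5 := sq_nonneg ‖u - v‖
    rw [mul_pow] at h3
    rw [mul_pow]
    norm_num
    nlinarith
  set u := hcontr.fixedPoint with hu
  have hfix : (S (hX.toLp u)).u = u := hcontr.fixedPoint_isFixedPt
  set γ := S (hX.toLp u) with hγ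
  have hP : γ.IsPerturbedHolomorphic H := by
    rw [LOne.isPerturbedHolomorphic_iff hX, hfix]
    exact hS _
  refine ⟨γ, hP, (hasMixedBoundaryValue_iff _ _).2 (hSb _), ?_⟩
  rw [hP.energy_eq]
  have hut : γ.ut = hX.toLp u - Complex.I • γ.uθ := by
    refine Lp.ext ?_
    filter_upwards [hS (hX.toLp u), Lp.coeFn_sub (hX.toLp u) (Complex.I • γ.uθ),
      Lp.coeFn_smul Complex.I γ.uθ] with p h1 h2 h3
    rw [h2, Pi.sub_apply, h3, Pi.smul_apply, ← h1, add_sub_cancel_right]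
  have hn : ‖γ.ut‖ ≤ ‖hX.toLp u‖ + ‖γ.uθ‖ := by
    rw [hut]
    refine (norm_sub_le _ _).trans ?_
    rw [norm_smul, Complex.norm_I, one_mul]
  have hn2 := (pow_le_pow_left₀ (norm_nonneg _) hn 2).trans add_sq_le
  have hG := hX.norm_toLp_sq_le hε.le u
  have hU := hSu (hX.toLp u)
  have hΘ := hSθ (hX.toLp u)
  rw [hfix] at hU
  set A := ∑' k, ‖modeBoundary b k‖ ^ 2
  have hA : 0 ≤ A := tsum_nonneg fun k => sq_nonneg _
  -- Inserting the bound on $\|u\|^2$ into that on $\|JX_H(u)\|^2$ produces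
  -- $4\epsilon^2K^2\|JX_H(u)\|^2\le\frac14\|JX_H(u)\|^2$ on the right, which is absorbed on the
  -- left. In the final bound $18=2+2\cdot8$ collects the contributions of $\|JX_H(u)\|^2$ to
  -- $2\|JX_H(u)\|^2+2\|\partial_\theta u\|^2$.
  have hG' : ‖hX.toLp u‖ ^ 2 ≤ ε * (8 * K ^ 2 * A + 8 * Real.pi * M ^ 2) := by
    have h1 := mul_le_mul_of_nonneg_left hU (by positivity : 0 ≤ 2 * K ^ 2)
    have h2 := mul_le_mul_of_nonneg_right hc (sq_nonneg ‖hX.toLp u‖)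
    nlinarith
  linarith

end

/-! ### Existence and uniqueness on short cylinders, with small energy. -/

theorem mainTheorem9 (n : ℕ) (H : Cn n → ℝ → ℝ) (hH : AdmissibleHamiltonian H) :
    (∃ ε₀ > 0, ∀ ε : ℝ, 0 < ε → ε ≤ ε₀ → ∀ b : ℝ → Cn n, MemLHalf b →
      ∃! γ : LOne n ε, γ.IsPerturbedHolomorphic H ∧ γ.HasMixedBoundaryValue b) ∧
    (∀ b : ℝ → Cn n, MemLHalf b → ∀ η : ℝ, 0 < η →
      ∃ ε₀ > 0, ∀ ε : ℝ, 0 < ε → ε ≤ ε₀ →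
        ∃! γ : LOne n ε,
          γ.IsPerturbedHolomorphic H ∧ γ.HasMixedBoundaryValue b ∧ γ.energy H < η) := by
  obtain ⟨K, M, hX⟩ := hH.exists_lipschitzField
  have hK : 0 < 1 / (4 * (K + 1)) := by have := hX.K_nonneg; positivity
  refine ⟨⟨_, hK, fun ε hε hεK b hb => ?_⟩, fun b hb η hη => ?_⟩
  · obtain ⟨γ, h1, h2, -⟩ := LOne.exists_isPerturbedHolomorphic hX hε hεK hb
    exact ⟨γ, ⟨h1, h2⟩, fun γ' h' =>
      LOne.isPerturbedHolomorphic_unique hX hε hεK h'.1 h1 h'.2 h2⟩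
  · set C := 18 * (8 * K ^ 2 * ∑' k, ‖LOne.modeBoundary b k‖ ^ 2 + 8 * Real.pi * M ^ 2)
    have hlim : Tendsto (fun ε => 4 * ∑' k, modeWeight ε k * ‖LOne.modeBoundary b k‖ ^ 2 + ε * C)
        (𝓝[>] 0) (𝓝 0) := by
      have h1 := (tendsto_tsum_modeWeight (LOne.summable_abs_mul_modeBoundary hb)).const_mul 4
      have h2 : Tendsto (fun ε : ℝ => ε * C) (𝓝[>] 0) (𝓝 (0 * C)) :=
        ((continuous_id.mul continuous_const).tendsto 0).mono_left nhdsWithin_le_nhds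
      simpa using h1.add h2
    obtain ⟨δ, hδ, hδη⟩ := mem_nhdsGT_iff_exists_Ioc_subset.1 (hlim.eventually_lt_const hη)
    refine ⟨min δ (1 / (4 * (K + 1))), lt_min hδ hK, fun ε hε hεm => ?_⟩
    have hεK := hεm.trans (min_le_right _ _)
    obtain ⟨γ, h1, h2, h3⟩ := LOne.exists_isPerturbedHolomorphic hX hε hεK hb
    have h4 := hδη ⟨hε, hεm.trans (min_le_left _ _)⟩
    -- Uniqueness ignores the energy bound: on so short a cylinder there is only one solution with
    -- boundary value $b$ at all.
    exact ⟨γ, ⟨h1, h2, h3.trans_lt h4⟩, fun γ' h' =>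
      LOne.isPerturbedHolomorphic_unique hX hε hεK h'.1 h1 h'.2.1 h2⟩
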